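/- **Lemma (brute-force halfspace intersection with noisy primitives).** Model. A CREW PRAM program is a finite text, independent of the input, consisting of synchronous parallel instructions (for all processors $i<m$: evaluate constantly many word operations on the shared memory and write one word; concurrent reads are allowed, concurrent writes are not), composed by sequencing, branching and loops. Words have $O(\log n)$ bits. The *span* is the number of parallel time steps and the *work* is the total number of operations of all processors. The $n$ input halfspaces are known to the program by their indices only, and their geometry is accessible only through a noisy Boolean primitive: given indices $a,b,c,d$, it tests whether the bounding planes $a,b,c$ meet in exactly one point and this point satisfies the inequality of halfspace $d$. Each execution of the primitive returns the wrong answer independently with probability at most $p$; operations on words are not noisy. Let $H$ be a family of $n$ closed halfspaces in $\mathbb{R}^3$ in general position, where all that is needed is that no vertex (extreme point) of $\bigcap H$ lies on more than three of the bounding planes. *Computing the intersection* $\bigcap H$ means writing its adjacency structure to the memory: a list in which every vertex of $\bigcap H$ occurs exactly once, with the three bounding planes that contain it, and for each of the three edges at that vertex (the intersection of $\bigcap H$ with two of these three planes) the vertex at its other end, or the information that the edge is an unbounded ray. Statement. For every $p$ with $0\le p<1/2$ and every constant $c$ there are a CREW PRAM program and a constant $C$ such that for every $n\ge 2$ and every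 family $H$ of $n$ halfspaces as above, with probability at least $1-n^{-c}$ the program computes $\bigcap H$ in span at most $C\log n$ and work at most $C\,n^4\log n$. -/

import Mathlib

open MeasureTheory ProbabilityTheory

/-! ### Halfspaces in three-dimensional space and their intersection -/

/-- A closed halfspace `{x | ⟪normal, x⟫ ≤ offset}` of `ℝ³`. -/
structure Halfspace where
  normal : EuclideanSpace ℝ (Fin 3)
  offset : ℝ
  normal_ne_zero : normal ≠ 0

namespace Halfspace

/-- The points of the halfspace. -/
def carrier (h : Halfspace) : Set (EuclideanSpace ℝ (Fin 3)) :=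
  {x | inner ℝ h.normal x ≤ h.offset}

/-- The bounding plane of the halfspace. -/
def plane (h : Halfspace) : Set (EuclideanSpace ℝ (Fin 3)) :=
  {x | inner ℝ h.normal x = h.offset}

end Halfspace

/-- The intersection of the halfspaces `H 0, …, H (n-1)`. -/
def halfspaceInter {n : ℕ} (H : Fin n → Halfspace) : Set (EuclideanSpace ℝ (Fin 3)) :=
  ⋂ l, (H l).carrier

/-- General position, in the weak form that only looks at the polyhedron itself: no vertex
(extreme point) of the intersection lies on more than three of the bounding planes. -/
def InGeneralPosition {n : ℕ} (H : Fin n → Halfspace) : Prop :=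
  ∀ x ∈ (halfspaceInter H).extremePoints ℝ, {l : Fin n | x ∈ (H l).plane}.ncard ≤ 3

/-- The combinatorial description of a polyhedron whose vertices are simple: a list of vertices,
for each vertex the indices of the three bounding planes through it, and for each vertex `a` and
each `s : Fin 3` the other endpoint of the edge that leaves `a` along the two planes other than
`facet a s`, or `none` if that edge is an unbounded ray. -/
structure AdjacencyStructure (n : ℕ) where
  numVertices : ℕ
  facet : Fin numVertices → Fin 3 → Fin n
  neighbor : Fin numVertices → Fin 3 → Option (Fin numVertices)

/-- `A` is the adjacency structure of the intersection of the halfspaces `H`: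
every vertex of the intersection is listed exactly once, with exactly the planes that contain it
(in increasing order), and each edge at each vertex is recorded with its correct other endpoint. -/
def AdjacencyStructure.Describes {n : ℕ} (A : AdjacencyStructure n) (H : Fin n → Halfspace) :
    Prop :=
  ∃ pt : Fin A.numVertices → EuclideanSpace ℝ (Fin 3),
    Function.Injective pt ∧
    Set.range pt = (halfspaceInter H).extremePoints ℝ ∧
    (∀ a, StrictMono (A.facet a) ∧ ∀ l, pt a ∈ (H l).plane ↔ ∃ s, A.facet a s = l) ∧
    ∀ a s,
      let edge := {x | x ∈ halfspaceInter H ∧ ∀ s', s' ≠ s → x ∈ (H (A.facet a s')).plane}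
      match A.neighbor a s with
      | some b => b ≠ a ∧ edge = segment ℝ (pt a) (pt b)
      | none => ∃ d, d ≠ 0 ∧ edge = {x | ∃ t : ℝ, 0 ≤ t ∧ x = pt a + t • d}

/-! ### The geometric primitive -/

/-- The sidedness test: the bounding planes number `a`, `b`, `c` meet in exactly one point
(a vertex of the arrangement), and that point satisfies the inequality of halfspace number `d`.
The test is false if an index is out of range. -/
def SideTest {n : ℕ} (H : Fin n → Halfspace) (a b c d : ℕ) : Prop :=
  ∃ i j k l : Fin n, (i : ℕ) = a ∧ (j : ℕ) = b ∧ (k : ℕ) = c ∧ (l : ℕ) = d ∧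
    ∃ x, (H i).plane ∩ (H j).plane ∩ (H k).plane = {x} ∧ x ∈ (H l).carrier

open Classical in
/-- The bit returned by a noisy evaluation of the Boolean primitive `q`: the truth value of `q`,
flipped if `err` is `true`. -/
noncomputable def noisyBit (q : Prop) (err : Bool) : ℕ :=
  if (q ↔ err = false) then 1 else 0

/-! ### CREW PRAM programs with noisy primitives -/

namespace PRAM

/-- The constant-time operations on words; comparisons of words (these are labels, pointers,
counters, never geometric data) return `0` or `1`, and subtraction is truncated. -/
inductive Op
  | add | sub | mul | div | mod | lt | eq

/-- The value of a word operation. -/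
def Op.eval : Op → ℕ → ℕ → ℕ
  | .add, x, y => x + y
  | .sub, x, y => x - y
  | .mul, x, y => x * y
  | .div, x, y => x / y
  | .mod, x, y => x % y
  | .lt, x, y => if x < y then 1 else 0
  | .eq, x, y => if x = y then 1 else 0

/-- Expressions that a single processor evaluates: constants, its own processor number, reads of
the shared memory, and word operations. -/
inductive Expr
  | lit (k : ℕ)
  | pid
  | read (addr : Expr)
  | op (o : Op) (x y : Expr)

/-- The value of an expression for processor `i` and shared memory `M`. -/
def Expr.eval (M : ℕ → ℕ) (i : ℕ) : Expr → ℕ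
  | .lit k => k
  | .pid => i
  | .read e => M (e.eval M i)
  | .op o x y => o.eval (x.eval M i) (y.eval M i)

/-- The number of elementary operations in the evaluation of an expression. -/
def Expr.size : Expr → ℕ
  | .lit _ => 1
  | .pid => 1
  | .read e => e.size + 1
  | .op _ x y => x.size + y.size + 1

/-- PRAM programs in work-span style: a program is a finite text, independent of the input.

* `assign m g a v`: all processors `i < m` in parallel, if their guard `g` is nonzero, write the
  value of `v` into the shared memory cell with address `a`;
* `test m g a q`: all processors `i < m` in parallel, if their guard `g` is nonzero, evaluate the
  noisy primitive at the halfspaces number `q 0, q 1, q 2, q 3` and write the bit that they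
  receive into the cell with address `a`;
* sequential composition, branching and loops, controlled by the shared memory. -/
inductive Prog
  | assign (m g a v : Expr)
  | test (m g a : Expr) (q : Fin 4 → Expr)
  | seq (P Q : Prog)
  | ite (e : Expr) (P Q : Prog)
  | loop (e : Expr) (P : Prog)

/-- A configuration: the shared memory, the number of parallel time steps so far (span), and the
number of operations of all processors so far (work). -/
structure Config where
  mem : ℕ → ℕ
  span : ℕ
  work : ℕ

/-- Add to a configuration the cost of `t` time steps in each of which `w` operations are
performed, and replace the memory by `M`. -/
def Config.advance (s : Config) (M : ℕ → ℕ) (t w : ℕ) : Config :=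
  ⟨M, s.span + t, s.work + t * w⟩

/-- `ExclusiveWrite W m g a v M M'`: the memory `M` becomes `M'` when all processors `i < m` with
`g i ≠ 0` simultaneously write `v i` to address `a i`. No two processors may write to the same
address, and every written value has to be a word, that is, at most `W`. -/
def ExclusiveWrite (W m : ℕ) (g a v : ℕ → ℕ) (M M' : ℕ → ℕ) : Prop :=
  (∀ i < m, ∀ j < m, g i ≠ 0 → g j ≠ 0 → a i = a j → i = j) ∧
  (∀ i < m, g i ≠ 0 → v i ≤ W) ∧
  (∀ i < m, g i ≠ 0 → M' (a i) = v i) ∧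
  (∀ x, (∀ i < m, g i ≠ 0 → a i ≠ x) → M' x = M x)

/-- Big-step execution of a program with word bound `W` on the halfspaces `H`. The outcome of the
primitive evaluated by processor `i` at time `t` is flipped iff `err (t, i) = true`; since every
instruction takes at least one time step, no two evaluations share an error bit.
Reads of a parallel step happen before its writes and may be concurrent. A program that violates
exclusive writing or the word bound, or that does not terminate, has no execution.
Every parallel instruction for `m` processors is charged for `m` processors and for one more that
does the control. -/
inductive Exec {n : ℕ} (H : Fin n → Halfspace) (W : ℕ) (err : ℕ × ℕ → Bool) :
    Prog → Config → Config → Prop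
  | assign (m g a v : Expr) (s : Config) (M' : ℕ → ℕ)
      (h : ExclusiveWrite W (m.eval s.mem 0) (fun i => g.eval s.mem i) (fun i => a.eval s.mem i)
        (fun i => v.eval s.mem i) s.mem M') :
      Exec H W err (.assign m g a v) s
        (s.advance M' (m.size + g.size + a.size + v.size) (m.eval s.mem 0 + 1))
  | test (m g a : Expr) (q : Fin 4 → Expr) (s : Config) (M' : ℕ → ℕ)
      (h : ExclusiveWrite W (m.eval s.mem 0) (fun i => g.eval s.mem i) (fun i => a.eval s.mem i)
        (fun i => noisyBit
          (SideTest H ((q 0).eval s.mem i) ((q 1).eval s.mem i) ((q 2).eval s.mem i)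
            ((q 3).eval s.mem i))
          (err (s.span, i))) s.mem M') :
      Exec H W err (.test m g a q) s
        (s.advance M' (m.size + g.size + a.size + (∑ j, (q j).size) + 1) (m.eval s.mem 0 + 1))
  | seq (P Q : Prog) (s₁ s₂ s₃ : Config)
      (hP : Exec H W err P s₁ s₂) (hQ : Exec H W err Q s₂ s₃) :
      Exec H W err (.seq P Q) s₁ s₃
  | ite_true (e : Expr) (P Q : Prog) (s s' : Config) (he : e.eval s.mem 0 ≠ 0)
      (hP : Exec H W err P (s.advance s.mem e.size 1) s') :
      Exec H W err (.ite e P Q) s s'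
  | ite_false (e : Expr) (P Q : Prog) (s s' : Config) (he : e.eval s.mem 0 = 0)
      (hQ : Exec H W err Q (s.advance s.mem e.size 1) s') :
      Exec H W err (.ite e P Q) s s'
  | loop_done (e : Expr) (P : Prog) (s : Config) (he : e.eval s.mem 0 = 0) :
      Exec H W err (.loop e P) s (s.advance s.mem e.size 1)
  | loop_step (e : Expr) (P : Prog) (s s' s'' : Config) (he : e.eval s.mem 0 ≠ 0)
      (hP : Exec H W err P (s.advance s.mem e.size 1) s')
      (hL : Exec H W err (.loop e P) s' s'') :
      Exec H W err (.loop e P) s s''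

/-- The initial configuration for `n` halfspaces: cell `0` holds `n` and all others hold `0`.
The halfspaces themselves are known to the machine by their numbers only. -/
def initial (n : ℕ) : Config :=
  ⟨fun x => if x = 0 then n else 0, 0, 0⟩

/-- The shared memory `M` holds the adjacency structure `A`: cell `0` holds the number `V` of
vertices and cell `1` the address of an array of `V` records of six words each: the three planes
of the vertex and its three neighbors, where the word `V` means that there is no neighbor. -/
def Holds {n : ℕ} (M : ℕ → ℕ) (A : AdjacencyStructure n) : Prop :=
  M 0 = A.numVertices ∧
  ∀ (a : Fin A.numVertices) (s : Fin 3),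
    M (M 1 + 6 * a + s) = A.facet a s ∧
    M (M 1 + 6 * a + 3 + s) = ((A.neighbor a s).elim A.numVertices (fun b => (b : ℕ)))

/-- With the error bits `err` and word bound `W`, the program `P` computes the intersection of the
halfspaces `H` within the given span and work. -/
def ComputesIntersection {n : ℕ} (P : Prog) (H : Fin n → Halfspace) (W : ℕ)
    (err : ℕ × ℕ → Bool) (span work : ℝ) : Prop :=
  ∃ s : Config, Exec H W err P (initial n) s ∧
    (s.span : ℝ) ≤ span ∧ (s.work : ℝ) ≤ work ∧
    ∃ A : AdjacencyStructure n, Holds s.mem A ∧ A.Describes H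

end PRAM

/-! ### Vertices and edges of an intersection of halfspaces -/

namespace Halfspace

variable {n : ℕ} {H : Fin n → Halfspace}

/-! A vertex of the polyhedron is a triple of planes that meet in one point lying in all halfspaces,
so the `n ^ 4` answers of the primitive determine the whole structure. Each question is asked in `K
* clog 2 n` rounds and decided by majority. The rounds take place at instants that do not depend on
the answers (`testTime`), so every vote uses a fixed set of distinct error bits. Hoeffding's
inequality and a union bound over the `n ^ 4` questions (`measure_exists_majority_wrong_le`) then
give failure probability at most `n ^ (-c)` for large `K`. Outside that event the rest is a
deterministic computation from correct answers.

Geometrically, an extreme point lies on at least three planes by a dimension count and on at most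
three by general position (`exists_isVertexOf`, `IsVertexOf.planes_through`). From a vertex on `i`,
`j`, `k`, the edge along `i` and `j` ends at a vertex on `i`, `j`, `l` if such an `l ≠ k` exists
(`edge_eq_segment`); this `l` is unique (`neighbor_unique`), and without it the ratio test shows
that the edge is a ray (`edge_eq_ray`). Hence adjacency can be read off the ternary relation
`PassesAllTests`, and the program analysis needs only the axioms `IsVertexRelation`.

The questions about one triple have consecutive numbers, so prefix sums of the answers reveal which
triples pass all tests. A second prefix sum over increasing triples numbers the vertices. The list
is written by edge ends (an edge `i < j` with an endpoint `k`): vertex number and position of `k`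
determine the edge end, which makes the writes exclusive, and uniqueness of `l` does the same for
the neighbors. Apart from the setup loop, the rounds and two prefix sums of length `n ^ 4`, all with
`O(log n)` iterations, every phase has constant span, and no step uses more than `6 * n ^ 4`
processors. -/

lemma mem_inter_iff {x : EuclideanSpace ℝ (Fin 3)} :
    x ∈ halfspaceInter H ↔ ∀ l, inner ℝ (H l).normal x ≤ (H l).offset := by
  simp [halfspaceInter, carrier]

/-- The bounding planes `i`, `j`, `k` meet exactly in the point `x` of the intersection. -/
def IsVertexOf (H : Fin n → Halfspace) (i j k : Fin n) (x : EuclideanSpace ℝ (Fin 3)) : Prop :=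
  (H i).plane ∩ (H j).plane ∩ (H k).plane = {x} ∧ x ∈ halfspaceInter H

namespace IsVertexOf

variable {i j k l m : Fin n} {x y z : EuclideanSpace ℝ (Fin 3)}

lemma swap_left (h : IsVertexOf H i j k x) : IsVertexOf H j i k x := by
  refine ⟨?_, h.2⟩
  rw [← h.1, Set.inter_comm (H j).plane]

lemma swap_right (h : IsVertexOf H i j k x) : IsVertexOf H i k j x := by
  refine ⟨?_, h.2⟩
  rw [← h.1, Set.inter_right_comm]

lemma mem_planes (h : IsVertexOf H i j k x) :
    inner ℝ (H i).normal x = (H i).offset ∧ inner ℝ (H j).normal x = (H j).offset ∧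
      inner ℝ (H k).normal x = (H k).offset := by
  have hx : x ∈ (H i).plane ∩ (H j).plane ∩ (H k).plane := by rw [h.1]; rfl
  exact ⟨hx.1.1, hx.1.2, hx.2⟩

lemma unique (h : IsVertexOf H i j k x) (h' : IsVertexOf H i j k y) : x = y := by
  have := h.1.symm.trans h'.1
  simpa using this

lemma eq_zero_of_orthogonal (h : IsVertexOf H i j k x) {d : EuclideanSpace ℝ (Fin 3)}
    (hi : inner ℝ (H i).normal d = 0) (hj : inner ℝ (H j).normal d = 0)
    (hk : inner ℝ (H k).normal d = 0) : d = 0 := by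
  obtain ⟨ai, aj, ak⟩ := h.mem_planes
  have : x + d ∈ (H i).plane ∩ (H j).plane ∩ (H k).plane := by
    refine ⟨⟨?_, ?_⟩, ?_⟩ <;> simp [plane, inner_add_right, *]
  rw [h.1] at this
  simpa using this

end IsVertexOf

lemma isVertexOf_of_forall_orthogonal {i j k : Fin n} {x : EuclideanSpace ℝ (Fin 3)}
    (hx : x ∈ halfspaceInter H)
    (hi : inner ℝ (H i).normal x = (H i).offset) (hj : inner ℝ (H j).normal x = (H j).offset)
    (hk : inner ℝ (H k).normal x = (H k).offset)
    (h : ∀ d, inner ℝ (H i).normal d = 0 → inner ℝ (H j).normal d = 0 →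
      inner ℝ (H k).normal d = 0 → d = 0) : IsVertexOf H i j k x := by
  refine ⟨Set.Subset.antisymm ?_ ?_, hx⟩
  · rintro y ⟨⟨yi, yj⟩, yk⟩
    simp only [plane, Set.mem_ofPred_eq] at yi yj yk
    have := h (y - x) (by simp [inner_sub_right, *]) (by simp [inner_sub_right, *])
      (by simp [inner_sub_right, *])
    simpa [sub_eq_zero] using this
  · rintro y rfl
    exact ⟨⟨hi, hj⟩, hk⟩

/-- Fewer than three linear forms on three-dimensional space have a common nontrivial zero. -/
lemma three_le_ncard_of_forall_orthogonal (T : Set (Fin n))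
    (h : ∀ d, (∀ l ∈ T, inner ℝ (H l).normal d = 0) → d = 0) : 3 ≤ T.ncard := by
  classical
  let f : EuclideanSpace ℝ (Fin 3) →ₗ[ℝ] (T → ℝ) :=
    LinearMap.pi fun l => (innerₗ _ (H l).normal)
  have hf : Function.Injective f := by
    rw [← LinearMap.ker_eq_bot, LinearMap.ker_eq_bot']
    intro d hd
    refine h d fun l hl => ?_
    simpa [f] using congrFun hd ⟨l, hl⟩
  have := LinearMap.finrank_le_finrank_of_injective hf
  simpa [Set.ncard_eq_toFinset_card'] using this

/-- The planes through an extreme point have no common direction. -/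
lemma eq_zero_of_mem_extremePoints {x : EuclideanSpace ℝ (Fin 3)}
    (hx : x ∈ (halfspaceInter H).extremePoints ℝ) {d : EuclideanSpace ℝ (Fin 3)}
    (hd : ∀ l, x ∈ (H l).plane → inner ℝ (H l).normal d = 0) : d = 0 := by
  have hxP := mem_inter_iff.1 hx.1
  -- Each constraint tolerates a small move along `±d`: a tight one because `d` is parallel to its
  -- plane, a slack one because it has room. The `+ 1` in the denominator covers forms that vanish
  -- on `d`.
  have key : ∀ l, ∃ ε : ℝ, 0 < ε ∧ ∀ t : ℝ, |t| ≤ ε →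
      inner ℝ (H l).normal (x + t • d) ≤ (H l).offset := by
    intro l
    by_cases hl : x ∈ (H l).plane
    · refine ⟨1, one_pos, fun t _ => ?_⟩
      have : inner ℝ (H l).normal x = (H l).offset := hl
      simp [inner_add_right, inner_smul_right, hd l hl, this]
    · have hlt : inner ℝ (H l).normal x < (H l).offset := lt_of_le_of_ne (hxP l) hl
      set b := inner ℝ (H l).normal d
      refine ⟨((H l).offset - inner ℝ (H l).normal x) / (|b| + 1),
        div_pos (by linarith) (by positivity), fun t ht => ?_⟩
      rw [le_div_iff₀ (by positivity)] at ht
      have h1 : t * b ≤ |t| * |b| := by rw [← abs_mul]; exact le_abs_self _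
      have h2 := abs_nonneg t
      simp only [inner_add_right, inner_smul_right]
      change _ + t * b ≤ _
      nlinarith
  choose ε hε hε' using key
  obtain ⟨δ, hδ, hδ'⟩ : ∃ δ : ℝ, 0 < δ ∧ ∀ l, δ ≤ ε l := by
    have : ∀ s : Finset (Fin n), ∃ δ : ℝ, 0 < δ ∧ ∀ l ∈ s, δ ≤ ε l := by
      intro s
      induction s using Finset.induction_on with
      | empty => exact ⟨1, one_pos, by simp⟩
      | insert a s _ ih =>
        obtain ⟨δ, h0, h1⟩ := ih
        refine ⟨min δ (ε a), lt_min h0 (hε a), fun l hl => ?_⟩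
        rcases Finset.mem_insert.1 hl with rfl | hl
        · exact min_le_right _ _
        · exact (min_le_left _ _).trans (h1 l hl)
    obtain ⟨δ, h0, h1⟩ := this Finset.univ
    exact ⟨δ, h0, fun l => h1 l (Finset.mem_univ _)⟩
  have hp : x + δ • d ∈ halfspaceInter H :=
    mem_inter_iff.2 fun l => hε' l δ (by rw [abs_of_pos hδ]; exact hδ' l)
  have hm : x + (-δ) • d ∈ halfspaceInter H :=
    mem_inter_iff.2 fun l => hε' l (-δ) (by rw [abs_neg, abs_of_pos hδ]; exact hδ' l)
  have hseg : x ∈ openSegment ℝ (x + δ • d) (x + (-δ) • d) :=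
    ⟨1 / 2, 1 / 2, by norm_num, by norm_num, by norm_num, by module⟩
  have := hx.2 hp hm hseg
  simpa [hδ.ne'] using this

namespace IsVertexOf

variable {i j k l m : Fin n} {x y z : EuclideanSpace ℝ (Fin 3)}

/-- A constraint that is tight inside a segment of the polyhedron is tight at its ends, so the ends
lie on all three planes, which share only one point. -/
lemma mem_extremePoints (h : IsVertexOf H i j k x) :
    x ∈ (halfspaceInter H).extremePoints ℝ := by
  refine ⟨h.2, ?_⟩
  rintro y hy z hz ⟨a, b, ha, hb, hab, rfl⟩
  have hy := mem_inter_iff.1 hy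
  have hz := mem_inter_iff.1 hz
  have tight : ∀ l, inner ℝ (H l).normal (a • y + b • z) = (H l).offset →
      inner ℝ (H l).normal y = (H l).offset := by
    intro l hl
    simp only [inner_add_right, inner_smul_right] at hl
    have h1 := hy l
    have h2 := mul_le_mul_of_nonneg_left (hz l) hb.le
    obtain rfl : b = 1 - a := by linarith
    refine le_antisymm h1 (le_of_mul_le_mul_left ?_ ha)
    linarith
  obtain ⟨hi, hj, hk⟩ := h.mem_planes
  have : y ∈ (H i).plane ∩ (H j).plane ∩ (H k).plane :=
    ⟨⟨tight i hi, tight j hj⟩, tight k hk⟩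
  rw [h.1] at this
  simpa using this

/-- The three normals have no common orthogonal direction, so the three indices are distinct and
already exhaust the number of planes that general position allows. -/
lemma planes_through (hH : InGeneralPosition H) (h : IsVertexOf H i j k x) :
    {l | x ∈ (H l).plane} = {i, j, k} := by
  obtain ⟨hi, hj, hk⟩ := h.mem_planes
  symm
  refine Set.eq_of_subset_of_ncard_le ?_ ?_ (Set.toFinite _)
  · rintro l (rfl | rfl | rfl) <;> assumption
  · refine (hH x h.mem_extremePoints).trans ?_
    exact three_le_ncard_of_forall_orthogonal (H := H) _ fun d hd =>
      h.eq_zero_of_orthogonal (hd i (by simp)) (hd j (by simp)) (hd k (by simp))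

lemma mem_plane_iff (hH : InGeneralPosition H) (h : IsVertexOf H i j k x) :
    x ∈ (H l).plane ↔ l = i ∨ l = j ∨ l = k := by
  simpa using Set.ext_iff.1 (h.planes_through hH) l

lemma ne_right (h : IsVertexOf H i j k x) : j ≠ k := by
  rintro rfl
  have := three_le_ncard_of_forall_orthogonal (H := H) {i, j} fun d hd =>
    h.eq_zero_of_orthogonal (hd i (by simp)) (hd j (by simp)) (hd j (by simp))
  have h2 := Set.ncard_insert_le i {j}
  simp only [Set.ncard_singleton] at h2
  omega

/-- The direction of the edge at `x` that leaves the plane `k`. -/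
lemma exists_direction (h : IsVertexOf H i j k x) : ∃ d : EuclideanSpace ℝ (Fin 3),
    inner ℝ (H i).normal d = 0 ∧ inner ℝ (H j).normal d = 0 ∧ inner ℝ (H k).normal d = -1 := by
  let f : EuclideanSpace ℝ (Fin 3) →ₗ[ℝ] (Fin 3 → ℝ) :=
    LinearMap.pi ![innerₗ _ (H i).normal, innerₗ _ (H j).normal, innerₗ _ (H k).normal]
  have hf : Function.Injective f := by
    rw [← LinearMap.ker_eq_bot, LinearMap.ker_eq_bot']
    intro d hd
    exact h.eq_zero_of_orthogonal (by simpa [f] using congrFun hd 0)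
      (by simpa [f] using congrFun hd 1) (by simpa [f] using congrFun hd 2)
  have hs : Function.Surjective f :=
    (LinearMap.injective_iff_surjective_of_finrank_eq_finrank (by simp)).1 hf
  obtain ⟨d, hd⟩ := hs ![0, 0, -1]
  exact ⟨d, by simpa [f] using congrFun hd 0, by simpa [f] using congrFun hd 1,
    by simpa [f] using congrFun hd 2⟩

/-- A point on the planes `i` and `j` lies on the ray from `x` in the direction of the edge. -/
lemma eq_add_smul (h : IsVertexOf H i j k x) {d : EuclideanSpace ℝ (Fin 3)}
    (di : inner ℝ (H i).normal d = 0) (dj : inner ℝ (H j).normal d = 0)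
    (dk : inner ℝ (H k).normal d = -1) (hy : y ∈ halfspaceInter H)
    (yi : y ∈ (H i).plane) (yj : y ∈ (H j).plane) : ∃ t : ℝ, 0 ≤ t ∧ y = x + t • d := by
  obtain ⟨hi, hj, hk⟩ := h.mem_planes
  simp only [plane, Set.mem_ofPred_eq] at yi yj
  -- The parameter is the slack of `k` at `y`, since `d` lowers the form of `k` at unit rate.
  refine ⟨(H k).offset - inner ℝ (H k).normal y, ?_, ?_⟩
  · have := mem_inter_iff.1 hy k
    linarith
  · have := h.eq_zero_of_orthogonal
      (d := y - x - ((H k).offset - inner ℝ (H k).normal y) • d)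
      (by simp [inner_sub_right, inner_smul_right, *])
      (by simp [inner_sub_right, inner_smul_right, *])
      (by simp [inner_sub_right, inner_smul_right, *])
    rw [sub_eq_zero, sub_eq_iff_eq_add] at this
    rw [add_comm]
    exact this

lemma ne_of_ne (hH : InGeneralPosition H) (hx : IsVertexOf H i j k x)
    (hy : IsVertexOf H i j l y) (hkl : l ≠ k) : x ∉ (H l).plane := by
  rw [hx.mem_plane_iff hH]
  rintro (rfl | rfl | rfl)
  · exact hy.swap_left.ne_right rfl
  · exact hy.ne_right rfl
  · exact hkl rfl

/-- All points of the edge have the form `x + t • d` with `t ≥ 0`. Constraint `l` is slack at `x`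
and tight at `y`, so its form grows along `d` and cuts the ray off at `y`. -/
lemma edge_eq_segment (hH : InGeneralPosition H) (hx : IsVertexOf H i j k x)
    (hy : IsVertexOf H i j l y) (hkl : l ≠ k) :
    y ≠ x ∧ {z | z ∈ halfspaceInter H ∧ z ∈ (H i).plane ∧ z ∈ (H j).plane} =
      segment ℝ x y := by
  have hxl := hx.ne_of_ne hH hy hkl
  have hxP := mem_inter_iff.1 hx.2
  have hyP := mem_inter_iff.1 hy.2
  obtain ⟨xi, xj, xk⟩ := hx.mem_planes
  obtain ⟨yi, yj, yl⟩ := hy.mem_planes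
  refine ⟨fun e => hxl (e ▸ yl), Set.Subset.antisymm ?_ ?_⟩
  · rintro z ⟨hz, zi, zj⟩
    obtain ⟨d, di, dj, dk⟩ := hx.exists_direction
    obtain ⟨t, ht, rfl⟩ := hx.eq_add_smul di dj dk hy.2 yi yj
    obtain ⟨s, hs, rfl⟩ := hx.eq_add_smul di dj dk hz zi zj
    have hzl := mem_inter_iff.1 hz l
    have hlt : inner ℝ (H l).normal x < (H l).offset := lt_of_le_of_ne (hxP l) hxl
    simp only [inner_add_right, inner_smul_right] at yl hzl
    have hdl : 0 < inner ℝ (H l).normal d := by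
      by_contra! hc
      nlinarith
    have hst : s ≤ t := by
      by_contra! hc
      nlinarith
    have htpos : 0 < t := by
      rcases ht.eq_or_lt with rfl | h
      · simp at yl; linarith
      · exact h
    refine ⟨1 - s / t, s / t, ?_, by positivity, by ring, ?_⟩
    · rw [sub_nonneg, div_le_one htpos]; exact hst
    · rw [smul_add, smul_smul, div_mul_cancel₀ _ htpos.ne']
      module
  · rintro z ⟨a, b, ha, hb, hab, rfl⟩
    refine ⟨mem_inter_iff.2 fun q => ?_, ?_, ?_⟩
    · simp only [inner_add_right, inner_smul_right]
      have := hxP q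
      have := hyP q
      have hb' : b = 1 - a := by linarith
      subst hb'
      nlinarith
    · simp only [plane, Set.mem_ofPred_eq, inner_add_right, inner_smul_right, xi, yi]
      rw [← add_mul, hab, one_mul]
    · simp only [plane, Set.mem_ofPred_eq, inner_add_right, inner_smul_right, xj, yj]
      rw [← add_mul, hab, one_mul]

/-- Ratio test of the simplex method: if some form grew along `d`, the first constraint met would
give a second vertex on `i` and `j`. So no form grows and the whole ray stays inside. -/
lemma edge_eq_ray (hx : IsVertexOf H i j k x)
    (hno : ∀ l y, l ≠ k → ¬ IsVertexOf H i j l y) :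
    ∃ d, d ≠ 0 ∧ {z | z ∈ halfspaceInter H ∧ z ∈ (H i).plane ∧ z ∈ (H j).plane} =
      {z | ∃ t : ℝ, 0 ≤ t ∧ z = x + t • d} := by
  classical
  obtain ⟨d, di, dj, dk⟩ := hx.exists_direction
  obtain ⟨xi, xj, xk⟩ := hx.mem_planes
  have hxP := mem_inter_iff.1 hx.2
  have hneg : ∀ l, inner ℝ (H l).normal d ≤ 0 := by
    by_contra! hc
    obtain ⟨l₀, hl₀⟩ := hc
    let r : Fin n → ℝ := fun l =>
      ((H l).offset - inner ℝ (H l).normal x) / inner ℝ (H l).normal d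
    obtain ⟨l, hl, hmin⟩ := Finset.exists_min_image
      (Finset.univ.filter fun l => 0 < inner ℝ (H l).normal d) r ⟨l₀, by simpa using hl₀⟩
    simp only [Finset.mem_filter, Finset.mem_univ, true_and] at hl hmin
    have hr0 : 0 ≤ r l := div_nonneg (by linarith [hxP l]) hl.le
    have hlk : l ≠ k := by
      rintro rfl
      linarith
    refine hno l (x + r l • d) hlk (isVertexOf_of_forall_orthogonal ?_ ?_ ?_ ?_ ?_)
    · refine mem_inter_iff.2 fun q => ?_
      simp only [inner_add_right, inner_smul_right]
      rcases le_or_gt (inner ℝ (H q).normal d) 0 with hq | hq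
      · have := hxP q
        nlinarith
      · have := hmin q hq
        have h2 : r q * inner ℝ (H q).normal d = (H q).offset - inner ℝ (H q).normal x :=
          div_mul_cancel₀ _ hq.ne'
        nlinarith
    · simp [inner_add_right, inner_smul_right, *]
    · simp [inner_add_right, inner_smul_right, *]
    · have h2 : r l * inner ℝ (H l).normal d = (H l).offset - inner ℝ (H l).normal x :=
          div_mul_cancel₀ _ hl.ne'
      simp only [inner_add_right, inner_smul_right, h2]
      ring
    -- A direction orthogonal to the normals of `i` and `j` is a multiple of `d`, on which the form
    -- of `l` does not vanish.
    · intro e ei ej el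
      have h1 : e + inner ℝ (H k).normal e • d = 0 :=
        hx.eq_zero_of_orthogonal (by simp [inner_add_right, inner_smul_right, *])
          (by simp [inner_add_right, inner_smul_right, *])
          (by simp [inner_add_right, inner_smul_right, *])
      have h2 : inner ℝ (H l).normal (e + inner ℝ (H k).normal e • d) = 0 := by
        rw [h1, inner_zero_right]
      simp only [inner_add_right, inner_smul_right, el, zero_add, mul_eq_zero, hl.ne',
        or_false] at h2
      simpa [h2] using h1
  refine ⟨d, ?_, Set.Subset.antisymm ?_ ?_⟩
  · rintro rfl
    simp at dk
  · rintro z ⟨hz, zi, zj⟩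
    exact hx.eq_add_smul di dj dk hz zi zj
  · rintro z ⟨t, ht, rfl⟩
    refine ⟨mem_inter_iff.2 fun q => ?_, ?_, ?_⟩
    · simp only [inner_add_right, inner_smul_right]
      have := hxP q
      have := hneg q
      nlinarith
    · simp [plane, inner_add_right, inner_smul_right, *]
    · simp [plane, inner_add_right, inner_smul_right, *]

/-- An edge has at most one endpoint other than a given one. -/
lemma neighbor_unique (hH : InGeneralPosition H) (hx : IsVertexOf H i j k x)
    (hy : IsVertexOf H i j l y) (hz : IsVertexOf H i j m z) (hkl : l ≠ k) (hkm : m ≠ k) :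
    l = m := by
  by_contra hlm
  -- If `l ≠ m`, then `y` and `z` are the two ends of this edge. The extreme point `x` lies between
  -- them and must coincide with one, which is excluded.
  obtain ⟨_, hseg⟩ := hy.edge_eq_segment hH hz (Ne.symm hlm)
  obtain ⟨xi, xj, xk⟩ := hx.mem_planes
  have hxs : x ∈ segment ℝ y z := by
    rw [← hseg]
    exact ⟨hx.2, xi, xj⟩
  rcases (mem_extremePoints_iff_forall_segment.1 hx.mem_extremePoints).2 _ hy.2 _ hz.2 hxs
    with e | e
  · exact (hx.edge_eq_segment hH hy hkl).1 e
  · exact (hx.edge_eq_segment hH hz hkm).1 e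

end IsVertexOf

/-- The planes through an extreme point have no common direction, so there are at least three;
general position leaves exactly three, which are then sorted. -/
lemma exists_isVertexOf (hH : InGeneralPosition H) {x : EuclideanSpace ℝ (Fin 3)}
    (hx : x ∈ (halfspaceInter H).extremePoints ℝ) :
    ∃ i j k, i < j ∧ j < k ∧ IsVertexOf H i j k x := by
  classical
  have h3 : 3 ≤ {l : Fin n | x ∈ (H l).plane}.ncard :=
    three_le_ncard_of_forall_orthogonal (H := H) _ fun d hd => eq_zero_of_mem_extremePoints hx hd
  have hcard : {l : Fin n | x ∈ (H l).plane}.toFinset.card = 3 := by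
    rw [← Set.ncard_eq_toFinset_card']
    exact le_antisymm (hH x hx) h3
  let f := Finset.orderEmbOfFin _ hcard
  have hf : ∀ s, x ∈ (H (f s)).plane := fun s => by
    have := Finset.orderEmbOfFin_mem _ hcard s
    rwa [Set.mem_toFinset] at this
  refine ⟨f 0, f 1, f 2, f.strictMono (by decide), f.strictMono (by decide),
    isVertexOf_of_forall_orthogonal hx.1 (hf 0) (hf 1) (hf 2) fun d h0 h1 h2 => ?_⟩
  refine eq_zero_of_mem_extremePoints hx fun l hl => ?_
  obtain ⟨s, rfl⟩ : ∃ s, f s = l := by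
    have := Finset.range_orderEmbOfFin _ hcard
    have hl' : l ∈ Set.range f := by rw [this]; simpa using hl
    exact hl'
  fin_cases s <;> assumption

end Halfspace

/-! ### Majority votes -/

/-- Hoeffding's inequality for the majority of independent noisy bits. -/
lemma measure_majority_wrong_le {ι Ω : Type*} [MeasurableSpace Ω] {μ : Measure Ω}
    [IsProbabilityMeasure μ] {err : ι → Ω → Bool} (hm : ∀ q, Measurable (err q))
    (hind : iIndepFun err μ) {p : ℝ} (hp₀ : 0 ≤ p) (hp : p < 1 / 2)
    (herr : ∀ q, μ {ω | err q ω = true} ≤ ENNReal.ofReal p)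
    {q : ℕ → ι} (hq : Function.Injective q) (R : ℕ) :
    μ {ω | R ≤ 2 * ((Finset.range R).filter fun r => err (q r) ω = true).card} ≤
      ENNReal.ofReal (Real.exp (-(2 * (1 / 2 - p) ^ 2 * R))) := by
  let b : Bool → ℝ := fun x => if x = true then 1 else 0
  have hb : Measurable b := measurable_of_finite _
  let Y : ℕ → Ω → ℝ := fun r ω => b (err (q r) ω)
  have hYm : ∀ r, Measurable (Y r) := fun r => hb.comp (hm _)
  have hYE : ∀ r, μ[Y r] ≤ p := by
    intro r
    have hset : MeasurableSet {ω | err (q r) ω = true} := hm (q r) (measurableSet_singleton true)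
    have : Y r = Set.indicator {ω | err (q r) ω = true} (fun _ => (1 : ℝ)) := by
      ext ω
      simp [Y, b, Set.indicator_apply]
    rw [this, integral_indicator_const _ hset, smul_eq_mul, mul_one]
    exact ENNReal.toReal_le_of_le_ofReal hp₀ (herr _)
  have hX : iIndepFun (fun r ω => Y r ω - μ[Y r]) μ :=
    (hind.precomp hq).comp (fun r x => b x - ∫ ω, Y r ω ∂μ) fun r => measurable_of_finite _
  -- Hoeffding's lemma for values in `[0, 1]`: the variance proxy is `(1 / 2) ^ 2`.
  have hsub : ∀ r < R, HasSubgaussianMGF (fun ω => Y r ω - μ[Y r]) ((‖(1 : ℝ) - 0‖₊ / 2) ^ 2) μ :=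
    fun r _ => hasSubgaussianMGF_of_mem_Icc (hYm r).aemeasurable <| by
      refine Filter.Eventually.of_forall fun ω => ?_
      simp only [Y, b]
      split_ifs <;> simp
  have key := HasSubgaussianMGF.measure_sum_range_ge_le_of_iIndepFun hX hsub
    (ε := (1 / 2 - p) * R) (mul_nonneg (by linarith) (Nat.cast_nonneg _))
  -- Ties count as wrong. At least `R / 2` errors, against a mean of at most `p * R`, force a
  -- deviation of `(1 / 2 - p) * R`.
  have hle : μ {ω | R ≤ 2 * ((Finset.range R).filter fun r => err (q r) ω = true).card} ≤
      μ {ω | (1 / 2 - p) * R ≤ ∑ r ∈ Finset.range R, (Y r ω - μ[Y r])} := by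
    refine measure_mono fun ω hω => ?_
    simp only [Set.mem_ofPred_eq] at hω ⊢
    have h1 : ∑ r ∈ Finset.range R, Y r ω =
        (((Finset.range R).filter fun r => err (q r) ω = true).card : ℝ) := by
      simp [Y, b]
    have h2 : ∑ r ∈ Finset.range R, μ[Y r] ≤ R * p := by
      simpa using Finset.sum_le_sum fun r (_ : r ∈ Finset.range R) => hYE r
    have h3 : (R : ℝ) ≤ 2 * (((Finset.range R).filter fun r => err (q r) ω = true).card : ℝ) := by
      exact_mod_cast hω
    rw [Finset.sum_sub_distrib, h1]
    linarith
  refine hle.trans ?_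
  rw [← ENNReal.ofReal_toReal (measure_ne_top μ {ω | (1 / 2 - p) * R ≤
    ∑ r ∈ Finset.range R, (Y r ω - μ[Y r])})]
  refine ENNReal.ofReal_le_ofReal (key.trans ?_)
  rw [Real.exp_le_exp]
  rcases Nat.eq_zero_or_pos R with rfl | hR
  · simp
  · have : (0 : ℝ) < R := by exact_mod_cast hR
    apply le_of_eq
    simp
    field_simp

/-- Many independent majority votes are all correct with high probability. -/
lemma measure_exists_majority_wrong_le {ι Ω : Type*} [MeasurableSpace Ω] {μ : Measure Ω}
    [IsProbabilityMeasure μ] {err : ι → Ω → Bool} (hm : ∀ q, Measurable (err q))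
    (hind : iIndepFun err μ) {p : ℝ} (hp₀ : 0 ≤ p) (hp : p < 1 / 2)
    (herr : ∀ q, μ {ω | err q ω = true} ≤ ENNReal.ofReal p)
    {q : ℕ → ℕ → ι} (hq : ∀ i, Function.Injective (q i)) {n R e : ℕ} (hn : 0 < n) {c : ℝ}
    (hR : (e + c) * Real.log n ≤ 2 * (1 / 2 - p) ^ 2 * R) :
    μ {ω | ∃ i < n ^ e, R ≤ 2 * ((Finset.range R).filter fun r => err (q i r) ω = true).card} ≤
      ENNReal.ofReal ((n : ℝ) ^ (-c)) := by
  have hn' : (0 : ℝ) < n := by exact_mod_cast hn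
  have : {ω | ∃ i < n ^ e,
        R ≤ 2 * ((Finset.range R).filter fun r => err (q i r) ω = true).card} ⊆
      ⋃ i ∈ Finset.range (n ^ e),
        {ω | R ≤ 2 * ((Finset.range R).filter fun r => err (q i r) ω = true).card} := by
    rintro ω ⟨i, hi, h⟩
    simp only [Set.mem_iUnion, Finset.mem_range]
    exact ⟨i, hi, h⟩
  -- The union bound needs no independence between different votes, hence injectivity is required
  -- only within each vote.
  refine (measure_mono this).trans <| (measure_biUnion_finset_le _ _).trans <|
    (Finset.sum_le_sum fun i _ =>
      measure_majority_wrong_le hm hind hp₀ hp herr (hq i) R).trans ?_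
  rw [Finset.sum_const, Finset.card_range, nsmul_eq_mul, ← ENNReal.ofReal_natCast,
    ← ENNReal.ofReal_mul (by positivity)]
  refine ENNReal.ofReal_le_ofReal ?_
  have h1 : ((n ^ e : ℕ) : ℝ) = Real.exp (Real.log n * e) := by
    rw [Real.exp_mul, Real.exp_log hn']
    simp
  rw [h1, Real.rpow_def_of_pos hn', ← Real.exp_add, Real.exp_le_exp]
  linarith

/-! ### Reasoning about programs -/

namespace PRAM

instance : Add Expr := ⟨.op .add⟩
instance : Sub Expr := ⟨.op .sub⟩
instance : Mul Expr := ⟨.op .mul⟩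
instance : Div Expr := ⟨.op .div⟩
instance : Mod Expr := ⟨.op .mod⟩
instance (k : ℕ) : OfNat Expr k := ⟨.lit k⟩

namespace Expr

/-- The expression that is `1` if `x < y` and `0` otherwise. -/
def less (x y : Expr) : Expr := .op .lt x y

/-- The expression that is `1` if `x = y` and `0` otherwise. -/
def equal (x y : Expr) : Expr := .op .eq x y

/-- The content of memory cell `r`. -/
def var (r : ℕ) : Expr := .read (.lit r)

end Expr

open PRAM.Expr

/-- Address of entry `x` of array number `r < 8`. -/
def cell (r x : ℕ) : ℕ := 8 * x + (8 + r)

/-- Expression for the address of an array entry. -/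
def cellExpr (r : ℕ) (x : Expr) : Expr := 8 * x + .lit (8 + r)

/-- Expression for the content of an array entry. -/
def entry (r : ℕ) (x : Expr) : Expr := .read (cellExpr r x)

section eval

variable (M : ℕ → ℕ) (i : ℕ) (x y : Expr) (k r : ℕ)

@[simp] lemma eval_add : (x + y).eval M i = x.eval M i + y.eval M i := rfl
@[simp] lemma eval_sub : (x - y).eval M i = x.eval M i - y.eval M i := rfl
@[simp] lemma eval_mul : (x * y).eval M i = x.eval M i * y.eval M i := rfl
@[simp] lemma eval_div : (x / y).eval M i = x.eval M i / y.eval M i := rfl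
@[simp] lemma eval_mod : (x % y).eval M i = x.eval M i % y.eval M i := rfl
@[simp] lemma eval_lit : (Expr.lit k).eval M i = k := rfl
@[simp] lemma eval_ofNat : (ofNat(k) : Expr).eval M i = k := rfl
@[simp] lemma eval_pid : Expr.pid.eval M i = i := rfl
@[simp] lemma eval_read : (Expr.read x).eval M i = M (x.eval M i) := rfl
@[simp] lemma eval_var : (var r).eval M i = M r := rfl
@[simp] lemma eval_less :
    (less x y).eval M i = if x.eval M i < y.eval M i then 1 else 0 := rfl
@[simp] lemma eval_equal :
    (equal x y).eval M i = if x.eval M i = y.eval M i then 1 else 0 := rfl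
@[simp] lemma eval_cellExpr : (cellExpr r x).eval M i = cell r (x.eval M i) := rfl
@[simp] lemma eval_entry : (entry r x).eval M i = M (cell r (x.eval M i)) := rfl

end eval

/-! ### Total-correctness rules with exact durations -/

section rules

variable {n : ℕ} (H : Fin n → Halfspace) (W Q : ℕ) (err : ℕ × ℕ → Bool)

/-- Started at time `t` on a memory that satisfies `pre`, the program `P` terminates after exactly
`δ` time steps, never uses more than `Q` processors at a time, and leaves a memory that satisfies
`post`. -/
def Runs (P : Prog) (t δ : ℕ) (pre post : (ℕ → ℕ) → Prop) : Prop :=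
  ∀ s : Config, s.span = t → pre s.mem →
    ∃ s', Exec H W err P s s' ∧ post s'.mem ∧ s'.span = t + δ ∧
      s'.work ≤ s.work + δ * (Q + 1)

/-- The effect of a parallel write of `m` processors. -/
def Wrote (m : ℕ) (g a v : ℕ → ℕ) (M M' : ℕ → ℕ) : Prop :=
  (∀ i < m, g i ≠ 0 → M' (a i) = v i) ∧ ∀ x, (∀ i < m, g i ≠ 0 → a i ≠ x) → M' x = M x

variable {H W Q err}

/-- Each address that is written has a single writer, so choosing a writer for it defines the new
memory consistently. -/
lemma exists_exclusiveWrite {m : ℕ} {g a v M : ℕ → ℕ}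
    (hinj : ∀ i < m, ∀ j < m, g i ≠ 0 → g j ≠ 0 → a i = a j → i = j)
    (hW : ∀ i < m, g i ≠ 0 → v i ≤ W) :
    ∃ M', ExclusiveWrite W m g a v M M' ∧ Wrote m g a v M M' := by
  classical
  have h1 : ∀ i < m, g i ≠ 0 →
      (fun x => if h : ∃ i, i < m ∧ g i ≠ 0 ∧ a i = x then v h.choose else M x) (a i) = v i := by
    intro i hi hg
    have h : ∃ i', i' < m ∧ g i' ≠ 0 ∧ a i' = a i := ⟨i, hi, hg, rfl⟩
    simp only [dif_pos h]
    rw [hinj _ h.choose_spec.1 _ hi h.choose_spec.2.1 hg h.choose_spec.2.2]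
  have h2 : ∀ x, (∀ i < m, g i ≠ 0 → a i ≠ x) →
      (fun x => if h : ∃ i, i < m ∧ g i ≠ 0 ∧ a i = x then v h.choose else M x) x = M x := by
    intro x hx
    exact dif_neg fun ⟨i, hi, hg, h⟩ => hx i hi hg h
  exact ⟨_, ⟨hinj, hW, h1, h2⟩, h1, h2⟩

lemma Runs.assign {m g a v : Expr} {t : ℕ} {pre post : (ℕ → ℕ) → Prop}
    (h : ∀ M, pre M → m.eval M 0 ≤ Q ∧
      (∀ i < m.eval M 0, ∀ j < m.eval M 0, g.eval M i ≠ 0 → g.eval M j ≠ 0 →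
        a.eval M i = a.eval M j → i = j) ∧
      (∀ i < m.eval M 0, g.eval M i ≠ 0 → v.eval M i ≤ W) ∧
      ∀ M', Wrote (m.eval M 0) (g.eval M) (a.eval M) (v.eval M) M M' → post M') :
    Runs H W Q err (.assign m g a v) t (m.size + g.size + a.size + v.size) pre post := by
  intro s hs hpre
  obtain ⟨hm, hinj, hW, hpost⟩ := h s.mem hpre
  obtain ⟨M', hM', hw⟩ := exists_exclusiveWrite hinj hW
  refine ⟨_, .assign m g a v s M' hM', hpost M' hw, ?_, ?_⟩
  · simp [Config.advance, hs]
  · simp only [Config.advance]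
    gcongr

/-- The error bits are indexed by time, so the postcondition can name them only because the starting
time is known exactly. -/
lemma Runs.test {m g a : Expr} {q : Fin 4 → Expr} {t : ℕ} {pre post : (ℕ → ℕ) → Prop}
    (hW0 : 1 ≤ W)
    (h : ∀ M, pre M → m.eval M 0 ≤ Q ∧
      (∀ i < m.eval M 0, ∀ j < m.eval M 0, g.eval M i ≠ 0 → g.eval M j ≠ 0 →
        a.eval M i = a.eval M j → i = j) ∧
      ∀ M', Wrote (m.eval M 0) (g.eval M) (a.eval M)
        (fun i => noisyBit (SideTest H ((q 0).eval M i) ((q 1).eval M i) ((q 2).eval M i)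
            ((q 3).eval M i)) (err (t, i))) M M' → post M') :
    Runs H W Q err (.test m g a q) t (m.size + g.size + a.size + (∑ j, (q j).size) + 1)
      pre post := by
  intro s hs hpre
  subst hs
  obtain ⟨hm, hinj, hpost⟩ := h s.mem hpre
  obtain ⟨M', hM', hw⟩ := exists_exclusiveWrite (W := W) (M := s.mem)
    (v := fun i => noisyBit (SideTest H ((q 0).eval s.mem i) ((q 1).eval s.mem i)
      ((q 2).eval s.mem i) ((q 3).eval s.mem i)) (err (s.span, i))) hinj (by
    intro i _ _
    unfold noisyBit
    split_ifs <;> omega)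
  refine ⟨_, .test m g a q s M' hM', hpost M' hw, ?_, ?_⟩
  · simp [Config.advance]
  · simp only [Config.advance]
    gcongr

lemma Runs.seq {P P' : Prog} {t δ δ' : ℕ} {pre mid post : (ℕ → ℕ) → Prop}
    (h : Runs H W Q err P t δ pre mid) (h' : Runs H W Q err P' (t + δ) δ' mid post) :
    Runs H W Q err (.seq P P') t (δ + δ') pre post := by
  intro s hs hpre
  obtain ⟨s₁, e₁, p₁, t₁, w₁⟩ := h s hs hpre
  obtain ⟨s₂, e₂, p₂, t₂, w₂⟩ := h' s₁ t₁ p₁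
  refine ⟨s₂, .seq _ _ _ _ _ e₁ e₂, p₂, by omega, ?_⟩
  rw [add_mul]
  omega

lemma Runs.mono {P : Prog} {t δ : ℕ} {pre pre' post post' : (ℕ → ℕ) → Prop}
    (h : Runs H W Q err P t δ pre post) (hpre : ∀ M, pre' M → pre M)
    (hpost : ∀ M, post M → post' M) : Runs H W Q err P t δ pre' post' := by
  intro s hs hp
  obtain ⟨s', h1, h2, h3⟩ := h s hs (hpre _ hp)
  exact ⟨s', h1, hpost _ h2, h3⟩

lemma Runs.loop {e : Expr} {P : Prog} {δ T : ℕ} {Inv : ℕ → (ℕ → ℕ) → Prop} {t : ℕ}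
    (hcont : ∀ r < T, ∀ M, Inv r M → e.eval M 0 ≠ 0) (hdone : ∀ M, Inv T M → e.eval M 0 = 0)
    (hbody : ∀ r < T,
      Runs H W Q err P (t + r * (e.size + δ) + e.size) δ (Inv r) (Inv (r + 1))) :
    Runs H W Q err (.loop e P) t (T * (e.size + δ) + e.size) (Inv 0) (Inv T) := by
  -- Induction on the number `j` of remaining iterations; the starting time of each iteration is
  -- known because all iterations last equally long.
  have main : ∀ j ≤ T, Runs H W Q err (.loop e P) (t + (T - j) * (e.size + δ))
      (j * (e.size + δ) + e.size) (Inv (T - j)) (Inv T) := by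
    intro j
    induction j with
    | zero =>
      intro _ s hs hpre
      refine ⟨_, .loop_done e P s (hdone _ hpre), hpre, by simp [Config.advance, hs], ?_⟩
      simp only [Config.advance, zero_mul, zero_add, mul_one]
      gcongr
      exact Nat.le_mul_of_pos_right _ (by omega)
    | succ j ih =>
      intro hj s hs hpre
      have hlt : T - (j + 1) < T := by omega
      obtain ⟨s₁, e₁, p₁, t₁, w₁⟩ := hbody _ hlt (s.advance s.mem e.size 1)
        (by simp [Config.advance, hs]) hpre
      have hT : T - (j + 1) + 1 = T - j := by omega
      rw [hT] at p₁
      obtain ⟨s₂, e₂, p₂, t₂, w₂⟩ := ih (by omega) s₁ (by rw [t₁, ← hT]; ring) p₁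
      refine ⟨s₂, .loop_step e P s s₁ s₂ (hcont _ hlt _ hpre) e₁ e₂, p₂, ?_, ?_⟩
      · rw [t₂, ← hT]; ring
      · simp only [Config.advance] at w₁
        nlinarith
  simpa using main T le_rfl

/-- Assignment to a single cell. -/
def setVar (r : ℕ) (e : Expr) : Prog := .assign 1 1 (.lit r) e

/-- The duration of an assignment to a single cell. -/
def setVarTime (e : Expr) : ℕ := 3 + e.size

lemma Runs.setVar {r : ℕ} {e : Expr} {t : ℕ} {pre post : (ℕ → ℕ) → Prop} (hQ : 1 ≤ Q)
    (h : ∀ M, pre M → e.eval M 0 ≤ W ∧ post (Function.update M r (e.eval M 0))) :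
    Runs H W Q err (setVar r e) t (setVarTime e) pre post := by
  refine Runs.assign fun M hM => ⟨hQ, ?_, ?_, ?_⟩
  · simp only [eval_ofNat]
    omega
  · simp only [eval_ofNat, Nat.lt_one_iff, forall_eq]
    exact fun _ => (h M hM).1
  · rintro M' ⟨h1, h2⟩
    convert (h M hM).2
    ext x
    by_cases hx : x = r
    · subst hx
      simpa using h1
    · rw [Function.update_of_ne hx]
      exact h2 x fun i _ _ => by simpa using Ne.symm hx

/-- All processors `i < m` write `v` into entry `i + o` of array `r`. -/
def fill (m : Expr) (r o : ℕ) (v : Expr) : Prog := .assign m 1 (cellExpr r (.pid + .lit o)) v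

/-- The duration of `fill`. -/
def fillTime (m : Expr) (r o : ℕ) (v : Expr) : ℕ :=
  m.size + 1 + (cellExpr r (.pid + .lit o)).size + v.size

lemma Runs.fill {m : Expr} {r o : ℕ} {v : Expr} {t : ℕ} {pre post : (ℕ → ℕ) → Prop}
    (h : ∀ M, pre M → m.eval M 0 ≤ Q ∧ (∀ i < m.eval M 0, v.eval M i ≤ W) ∧
      ∀ M', (∀ i < m.eval M 0, M' (cell r (i + o)) = v.eval M i) →
        (∀ x, (∀ i < m.eval M 0, cell r (i + o) ≠ x) → M' x = M x) → post M') :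
    Runs H W Q err (fill m r o v) t (fillTime m r o v) pre post := by
  refine Runs.assign fun M hM => ?_
  obtain ⟨h1, h2, h3⟩ := h M hM
  refine ⟨h1, ?_, fun i hi _ => h2 i hi, ?_⟩
  · intro i _ j _ _ _ hij
    simpa [cell] using hij
  · rintro M' ⟨h4, h5⟩
    exact h3 M' (fun i hi => h4 i hi (by simp)) fun x hx => h5 x fun i hi _ => hx i hi

end rules

end PRAM

/-! ### Numbering the vertices -/

namespace PRAM

lemma mul_add_div_self {n a b : ℕ} (hb : b < n) : (a * n + b) / n = a := by
  rw [mul_comm, Nat.mul_add_div (by omega), Nat.div_eq_of_lt hb, add_zero]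

lemma mul_add_mod_self {n a b : ℕ} (hb : b < n) : (a * n + b) % n = b := by
  rw [mul_comm, Nat.mul_add_mod, Nat.mod_eq_of_lt hb]

/-- The number with the three base-`n` digits `i`, `j`, `k`. -/
def encode (n i j k : ℕ) : ℕ := (i * n + j) * n + k

section encode

variable {n i j k i' j' k' x : ℕ}

lemma encode_div (hk : k < n) : encode n i j k / n = i * n + j := mul_add_div_self hk

lemma encode_mod (hk : k < n) : encode n i j k % n = k := mul_add_mod_self hk

lemma encode_div_div (hj : j < n) (hk : k < n) : encode n i j k / n / n = i := by
  rw [encode_div hk, mul_add_div_self hj]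

lemma encode_div_mod (hj : j < n) (hk : k < n) : encode n i j k / n % n = j := by
  rw [encode_div hk, mul_add_mod_self hj]

lemma encode_lt (hi : i < n) (hj : j < n) (hk : k < n) : encode n i j k < n ^ 3 := by
  have h1 : i * n + j < n * n := by nlinarith
  have h2 : (i * n + j) * n + k < n * n * n := by nlinarith
  calc _ < n * n * n := h2
    _ = n ^ 3 := by ring

lemma encode_digits (x : ℕ) : encode n (x / n / n) (x / n % n) (x % n) = x := by
  rw [encode, Nat.div_add_mod', Nat.div_add_mod']

lemma encode_inj (hj : j < n) (hk : k < n) (hj' : j' < n) (hk' : k' < n)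
    (h : encode n i j k = encode n i' j' k') : i = i' ∧ j = j' ∧ k = k' := by
  refine ⟨?_, ?_, ?_⟩
  · rw [← encode_div_div (i := i) hj hk, h, encode_div_div hj' hk']
  · rw [← encode_div_mod (i := i) hj hk, h, encode_div_mod hj' hk']
  · rw [← encode_mod (i := i) (j := j) hk, h, encode_mod hk']

end encode

/-- The combinatorial properties of the relation `three planes meet in a vertex`. -/
structure IsVertexRelation (n : ℕ) (Good : ℕ → ℕ → ℕ → Prop) : Prop where
  lt : ∀ {i j k}, Good i j k → k < n
  swap_left : ∀ {i j k}, Good i j k → Good j i k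
  swap_right : ∀ {i j k}, Good i j k → Good i k j
  ne : ∀ {i j k}, Good i j k → j ≠ k
  unique : ∀ {i j k l m}, Good i j k → Good i j l → Good i j m → l ≠ k → m ≠ k → l = m

/-- `x` encodes an edge, given by two planes in increasing order, together with one of its
endpoints, given by the third plane. -/
def IsEdgeEnd (n : ℕ) (Good : ℕ → ℕ → ℕ → Prop) (x : ℕ) : Prop :=
  x / n / n < x / n % n ∧ Good (x / n / n) (x / n % n) (x % n)

/-- `x` encodes a vertex, given by three planes in increasing order. -/
def IsVertexCode (n : ℕ) (Good : ℕ → ℕ → ℕ → Prop) (x : ℕ) : Prop :=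
  x / n % n < x % n ∧ IsEdgeEnd n Good x

/-- The code whose digits are those of `x` in increasing order, if the first two digits of `x`
are in increasing order. -/
def sortCode (n x : ℕ) : ℕ :=
  encode n (x / n / n - (x / n / n - x % n))
    (x / n / n + x / n % n + x % n - (x / n / n - (x / n / n - x % n)) -
      (x / n % n + (x % n - x / n % n)))
    (x / n % n + (x % n - x / n % n))

/-- The position of the last digit of `x` among the digits in increasing order. -/
def slot (n x : ℕ) : ℕ :=
  (if x / n / n < x % n then 1 else 0) + (if x / n % n < x % n then 1 else 0)

lemma slot_lt (n x : ℕ) : slot n x < 3 := by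
  unfold slot
  split_ifs <;> omega

open Classical in
/-- The number of vertex codes below `x`. -/
noncomputable def codeCount (n : ℕ) (Good : ℕ → ℕ → ℕ → Prop) (x : ℕ) : ℕ :=
  Nat.count (IsVertexCode n Good) x

/-- The index in the list of vertices of the endpoint encoded by `x`. -/
noncomputable def rank (n : ℕ) (Good : ℕ → ℕ → ℕ → Prop) (x : ℕ) : ℕ :=
  codeCount n Good (sortCode n x)

section numbering

variable {n : ℕ} {Good : ℕ → ℕ → ℕ → Prop} {i j k x y : ℕ}

lemma isEdgeEnd_encode (hG : IsVertexRelation n Good)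
    (hij : i < j) (h : Good i j k) : IsEdgeEnd n Good (encode n i j k) := by
  have hk := hG.lt h
  have hj := hG.lt (hG.swap_right h)
  rw [IsEdgeEnd, encode_div_div hj hk, encode_div_mod hj hk, encode_mod hk]
  exact ⟨hij, h⟩

lemma IsEdgeEnd.exists_eq (hG : IsVertexRelation n Good)
    (hx : IsEdgeEnd n Good x) : ∃ i j k, x = encode n i j k ∧
    i < j ∧ Good i j k ∧ j < n ∧ k < n ∧ i ≠ k ∧ j ≠ k :=
  ⟨_, _, _, (encode_digits x).symm, hx.1, hx.2, hG.lt (hG.swap_right hx.2), hG.lt hx.2,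
    hG.ne (hG.swap_left hx.2), hG.ne hx.2⟩

lemma IsEdgeEnd.lt (hG : IsVertexRelation n Good) (hx : IsEdgeEnd n Good x) : x < n ^ 3 := by
  obtain ⟨i, j, k, rfl, hij, h, hj, hk, -, -⟩ := hx.exists_eq hG
  exact encode_lt (by omega) hj hk

end numbering

section sorting

variable {n : ℕ} {i j k : ℕ}

/-- With truncated subtraction, `i - (i - k)` is a minimum and `j + (k - j)` a maximum. If `i < j`,
these are the extremes of the three digits, and the middle one is what remains of their sum. -/
lemma sortCode_encode (hj : j < n) (hk : k < n) : sortCode n (encode n i j k) =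
    encode n (i - (i - k)) (i + j + k - (i - (i - k)) - (j + (k - j))) (j + (k - j)) := by
  rw [sortCode, encode_div_div hj hk, encode_div_mod hj hk, encode_mod hk]

lemma slot_encode (hj : j < n) (hk : k < n) : slot n (encode n i j k) =
    (if i < k then 1 else 0) + (if j < k then 1 else 0) := by
  rw [slot, encode_div_div hj hk, encode_div_mod hj hk, encode_mod hk]

lemma sortCode_encode_of_lt (hij : i < j) (hjk : j < k) (hk : k < n) :
    sortCode n (encode n i j k) = encode n i j k := by
  rw [sortCode_encode (by omega) hk]
  congr 1 <;> omega

lemma sortCode_encode_mid (hik : i < k) (hkj : k < j) (hj : j < n) :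
    sortCode n (encode n i j k) = encode n i k j := by
  rw [sortCode_encode hj (by omega)]
  congr 1 <;> omega

lemma sortCode_encode_of_gt (hki : k < i) (hij : i < j) (hj : j < n) :
    sortCode n (encode n i j k) = encode n k i j := by
  rw [sortCode_encode hj (by omega)]
  congr 1 <;> omega

end sorting

section numbering

variable {n : ℕ} {Good : ℕ → ℕ → ℕ → Prop} {i j k x y : ℕ}

lemma isVertexCode_encode (hG : IsVertexRelation n Good)
    (hij : i < j) (hjk : j < k) (h : Good i j k) :
    IsVertexCode n Good (encode n i j k) := by
  have hk := hG.lt h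
  refine ⟨?_, isEdgeEnd_encode hG hij h⟩
  rw [encode_div_mod (by omega) hk, encode_mod hk]
  exact hjk

lemma IsEdgeEnd.isVertexCode_sortCode (hG : IsVertexRelation n Good) (hx : IsEdgeEnd n Good x) :
    IsVertexCode n Good (sortCode n x) := by
  obtain ⟨i, j, k, rfl, hij, h, hj, hk, hik, hjk⟩ := hx.exists_eq hG
  rcases lt_or_gt_of_ne hjk with h1 | h1
  · rw [sortCode_encode_of_lt hij h1 hk]
    exact isVertexCode_encode hG hij h1 h
  · rcases lt_or_gt_of_ne hik with h2 | h2
    · rw [sortCode_encode_mid h2 h1 hj]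
      exact isVertexCode_encode hG h2 h1 (hG.swap_right h)
    · rw [sortCode_encode_of_gt h2 hij hj]
      exact isVertexCode_encode hG h2 hij (hG.swap_left (hG.swap_right h))

/-- The sorted code gives the set of digits and the slot tells which of them comes last; the other
two are in increasing order. This injectivity is what makes the writes to the list exclusive. -/
lemma IsEdgeEnd.eq_of_sortCode_eq (hG : IsVertexRelation n Good)
    (hx : IsEdgeEnd n Good x) (hy : IsEdgeEnd n Good y)
    (h1 : sortCode n x = sortCode n y) (h2 : slot n x = slot n y) : x = y := by
  obtain ⟨i, j, k, rfl, hij, h, hj, hk, hik, hjk⟩ := hx.exists_eq hG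
  obtain ⟨i', j', k', rfl, hij', h', hj', hk', hik', hjk'⟩ := hy.exists_eq hG
  rw [sortCode_encode hj hk, sortCode_encode hj' hk'] at h1
  obtain ⟨e1, e2, e3⟩ := encode_inj (by omega) (by omega) (by omega) (by omega) h1
  rw [slot_encode hj hk, slot_encode hj' hk'] at h2
  have : i = i' ∧ j = j' ∧ k = k' := by split_ifs at h2 <;> omega
  obtain ⟨rfl, rfl, rfl⟩ := this
  rfl

lemma IsVertexCode.lt (hG : IsVertexRelation n Good)
    (hx : IsVertexCode n Good x) : x < n ^ 3 := hx.2.lt hG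

lemma codeCount_injective (hx : IsVertexCode n Good x) (hy : IsVertexCode n Good y)
    (h : codeCount n Good x = codeCount n Good y) : x = y := by
  classical
  exact Nat.count_injective hx hy h

lemma IsEdgeEnd.eq_of_rank_eq (hG : IsVertexRelation n Good)
    (hx : IsEdgeEnd n Good x) (hy : IsEdgeEnd n Good y)
    (h1 : rank n Good x = rank n Good y) (h2 : slot n x = slot n y) : x = y :=
  hx.eq_of_sortCode_eq hG hy (codeCount_injective (hx.isVertexCode_sortCode hG)
    (hy.isVertexCode_sortCode hG) h1) h2

lemma IsEdgeEnd.sortCode_lt (hG : IsVertexRelation n Good)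
    (hx : IsEdgeEnd n Good x) : sortCode n x < n ^ 3 :=
  (hx.isVertexCode_sortCode hG).lt hG

lemma codeCount_lt_codeCount (hx : IsVertexCode n Good x) (hxy : x < y) :
    codeCount n Good x < codeCount n Good y := by
  classical
  exact Nat.count_strict_mono hx hxy

lemma IsEdgeEnd.rank_lt (hG : IsVertexRelation n Good)
    (hx : IsEdgeEnd n Good x) : rank n Good x < codeCount n Good (n ^ 3) :=
  codeCount_lt_codeCount (hx.isVertexCode_sortCode hG) (hx.sortCode_lt hG)

lemma codeCount_le (x : ℕ) : codeCount n Good x ≤ x := by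
  classical
  exact Nat.count_le _

/-- The prefix sums extend to `n ^ 4`, but no code reaches `n ^ 3`, so the last prefix sum is the
number of vertices. -/
lemma codeCount_eq_of_le (hG : IsVertexRelation n Good)
    (hx : n ^ 3 ≤ x) : codeCount n Good x = codeCount n Good (n ^ 3) := by
  obtain ⟨d, rfl⟩ := Nat.exists_eq_add_of_le hx
  classical
  unfold codeCount
  rw [Nat.count_add]
  have : Nat.count (fun k => IsVertexCode n Good (n ^ 3 + k)) d = 0 := by
    rw [Nat.count_eq_card_filter_range, Finset.card_eq_zero, Finset.filter_eq_empty_iff]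
    intro y _ hy
    have := hy.lt hG
    omega
  convert (add_zero _) using 2

/-- Every vertex index is the number of a unique vertex code. -/
lemma exists_isVertexCode {a : ℕ} (ha : a < codeCount n Good (n ^ 3)) :
    ∃ i j k, i < j ∧ j < k ∧ Good i j k ∧ codeCount n Good (encode n i j k) = a := by
  classical
  have key : ∀ y, a < codeCount n Good y → ∃ x, IsVertexCode n Good x ∧ codeCount n Good x = a := by
    intro y
    induction y with
    | zero => intro h; simp [codeCount] at h
    | succ y ih =>
      intro h
      rw [codeCount, Nat.count_succ] at h
      by_cases hy : a < codeCount n Good y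
      · exact ih hy
      · unfold codeCount at hy
        split_ifs at h with hc
        · exact ⟨y, hc, by unfold codeCount; omega⟩
        · omega
  obtain ⟨x, hx, hxa⟩ := key _ ha
  exact ⟨_, _, _, hx.2.1, hx.1, hx.2.2, by rw [encode_digits]; exact hxa⟩

/-- The three edges at a vertex. -/
lemma exists_isEdgeEnd (hG : IsVertexRelation n Good)
    (hij : i < j) (hjk : j < k) (h : Good i j k) (s : Fin 3) :
    ∃ u v : ℕ, IsEdgeEnd n Good (encode n u v (![i, j, k] s)) ∧
      sortCode n (encode n u v (![i, j, k] s)) = encode n i j k ∧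
      slot n (encode n u v (![i, j, k] s)) = s ∧ u < v ∧ v < n ∧
      (∀ w, (w = u ∨ w = v) ↔ ∃ s', s' ≠ s ∧ w = ![i, j, k] s') := by
  have hk := hG.lt h
  fin_cases s
  · refine ⟨j, k, isEdgeEnd_encode hG hjk (hG.swap_right (hG.swap_left h)),
      sortCode_encode_of_gt hij hjk hk, ?_, hjk, hk, fun w => ?_⟩
    · rw [slot_encode hk (by simp; omega)]
      change (if j < i then 1 else 0) + (if k < i then 1 else 0) = 0
      split_ifs <;> omega
    · simp [Fin.exists_fin_succ]
  · refine ⟨i, k, isEdgeEnd_encode hG (hij.trans hjk) (hG.swap_right h),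
      sortCode_encode_mid hij hjk hk, ?_, hij.trans hjk, hk, fun w => ?_⟩
    · rw [slot_encode hk (by simp; omega)]
      change (if i < j then 1 else 0) + (if k < j then 1 else 0) = 1
      split_ifs <;> omega
    · simp [Fin.exists_fin_succ]
  · refine ⟨i, j, isEdgeEnd_encode hG hij h,
      sortCode_encode_of_lt hij hjk hk, ?_, hij, by omega, fun w => ?_⟩
    · rw [slot_encode (by omega) (by simpa using hk)]
      change (if i < k then 1 else 0) + (if j < k then 1 else 0) = 2
      split_ifs <;> omega
    · simp [Fin.exists_fin_succ]

end numbering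

end PRAM

/-! ### Repeated tests, majority votes and prefix sums -/

namespace PRAM

open PRAM.Expr

/-- Cell `2` receives `n ^ 4` and cell `4` receives `K` times the binary logarithm of `n`. -/
def setup (K : ℕ) : Prog :=
  .seq (setVar 2 (var 0 * var 0 * var 0 * var 0)) <| .seq (setVar 3 1) <|
    .loop (less (var 3) (var 0)) <| .seq (setVar 3 (2 * var 3)) (setVar 4 (var 4 + .lit K))

/-- Every processor tests the four digits of its number once and stores the answer. -/
def testAll : Prog :=
  .test (var 2) 1 (cellExpr 0 .pid)
    ![.pid / var 0 / var 0 / var 0, .pid / var 0 / var 0 % var 0, .pid / var 0 % var 0,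
      .pid % var 0]

/-- One round of tests, whose positive answers are counted in array `1`. -/
def round : Prog :=
  .seq testAll <| .seq (fill (var 2) 1 0 (entry 1 .pid + entry 0 .pid)) (setVar 5 (var 5 + 1))

/-- All rounds of tests. -/
def vote : Prog := .loop (less (var 5) (var 4)) round

/-- The majority of the answers to each test, stored in array `2` with a shift by one. -/
def majority : Prog := fill (var 2) 2 1 (less (var 4) (2 * entry 1 .pid))

/-- Prefix sums of array `r`. -/
def prefixSum (r : ℕ) : Prog :=
  .seq (setVar 3 1) <| .loop (less (var 3) (var 2)) <|
    .seq (fill (var 2) r 1 (entry r (.pid + 1) + entry r (.pid + 1 - var 3)))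
      (setVar 3 (2 * var 3))

/-- Duration of one iteration of the loop in `setup`. -/
def setupStep (K : ℕ) : ℕ :=
  (less (var 3) (var 0)).size + (setVarTime (2 * var 3) + setVarTime (var 4 + .lit K))

/-- Duration of `setup` if its loop is iterated `T` times. -/
def setupTime (K T : ℕ) : ℕ :=
  setVarTime (var 0 * var 0 * var 0 * var 0) +
    (setVarTime 1 + (T * setupStep K + (less (var 3) (var 0)).size))

/-- Duration of `testAll`. -/
def testAllTime : ℕ :=
  (var 2).size + (1 : Expr).size + (cellExpr 0 .pid).size +
    (∑ j, ((![.pid / var 0 / var 0 / var 0, .pid / var 0 / var 0 % var 0, .pid / var 0 % var 0,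
      .pid % var 0] : Fin 4 → Expr) j).size) + 1

/-- Duration of one iteration of the loop in `vote`. -/
def voteStep : ℕ :=
  (less (var 5) (var 4)).size +
    (testAllTime + (fillTime (var 2) 1 0 (entry 1 .pid + entry 0 .pid) + setVarTime (var 5 + 1)))

/-- Duration of `vote` if its loop is iterated `T` times. -/
def voteTime (T : ℕ) : ℕ := T * voteStep + (less (var 5) (var 4)).size

/-- The time at which round number `r` evaluates the primitive, if `vote` starts at time `t`. -/
def testTime (t r : ℕ) : ℕ := t + r * voteStep + (less (var 5) (var 4)).size

/-- Duration of `majority`. -/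
def majorityTime : ℕ := fillTime (var 2) 2 1 (less (var 4) (2 * entry 1 .pid))

/-- Duration of one iteration of the loop in `prefixSum`. -/
def prefixSumStep (r : ℕ) : ℕ :=
  (less (var 3) (var 2)).size +
    (fillTime (var 2) r 1 (entry r (.pid + 1) + entry r (.pid + 1 - var 3)) +
      setVarTime (2 * var 3))

/-- Duration of `prefixSum` if its loop is iterated `T` times. -/
def prefixSumTime (r T : ℕ) : ℕ :=
  setVarTime 1 + (T * prefixSumStep r + (less (var 3) (var 2)).size)

/-- The arrays are interleaved modulo 8 above the scalar cells, so none of them can collide,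
whatever their lengths. -/
lemma cell_ne {q : ℕ} (hq : q < 8) (r x : ℕ) : cell r x ≠ q := by
  unfold cell
  omega

lemma update_cell (M : ℕ → ℕ) {q : ℕ} (hq : q < 8) (v r x : ℕ) :
    Function.update M q v (cell r x) = M (cell r x) :=
  Function.update_of_ne (cell_ne hq r x) _ _

lemma noisyBit_le_one (q : Prop) (e : Bool) : noisyBit q e ≤ 1 := by
  unfold noisyBit
  split_ifs <;> omega

/-- If fewer than half of the answers are wrong, their majority is correct. -/
lemma lt_two_mul_sum_noisyBit_iff (q : Prop) (e : ℕ → Bool) (R : ℕ)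
    (h : 2 * ((Finset.range R).filter fun r => e r = true).card < R) :
    R < 2 * ∑ r ∈ Finset.range R, noisyBit q (e r) ↔ q := by
  by_cases hq : q
  · have h1 : ∑ r ∈ Finset.range R, noisyBit q (e r) =
        ((Finset.range R).filter fun r => ¬ e r = true).card := by
      simp [noisyBit, hq]
    have h2 := Finset.card_filter_add_card_filter_not (s := Finset.range R) (fun r => e r = true)
    rw [Finset.card_range] at h2
    rw [h1, iff_true_right hq]
    omega
  · have h1 : ∑ r ∈ Finset.range R, noisyBit q (e r) =
        ((Finset.range R).filter fun r => e r = true).card := by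
      simp [noisyBit, hq]
    rw [h1, iff_false_right hq]
    omega

/-! ### Correctness of the voting and prefix-sum phases -/

section phases

variable {n : ℕ} {H : Fin n → Halfspace} {W Q : ℕ} {err : ℕ × ℕ → Bool} {t : ℕ}

/-- Doubling cell `3` until it reaches `n` takes `clog 2 n` iterations, each of which adds `K` to
the number of rounds. The cells from `5` on stay zero and serve as initialized counters and arrays.
-/
lemma runs_setup (K : ℕ) (hQ : 1 ≤ Q) (hn : 2 ≤ n) (hN : 2 * n ^ 4 ≤ W)
    (hK : K * Nat.clog 2 n ≤ W) :
    Runs H W Q err (setup K) t (setupTime K (Nat.clog 2 n))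
      (fun M => M = fun x => if x = 0 then n else 0)
      (fun M => M 0 = n ∧ M 2 = n ^ 4 ∧ M 4 = K * Nat.clog 2 n ∧ ∀ x, 5 ≤ x → M x = 0) := by
  have hnN : n ≤ n ^ 4 := Nat.le_self_pow (by norm_num) n
  refine Runs.seq (mid := fun M => M 0 = n ∧ M 2 = n ^ 4 ∧ M 4 = 0 ∧ ∀ x, 5 ≤ x → M x = 0)
    (Runs.setVar hQ ?_) <|
    Runs.seq (mid := fun M => M 0 = n ∧ M 2 = n ^ 4 ∧ M 3 = 1 ∧ M 4 = 0 ∧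
      ∀ x, 5 ≤ x → M x = 0) (Runs.setVar hQ ?_) <|
    Runs.mono (Runs.loop (Inv := fun r M => M 0 = n ∧ M 2 = n ^ 4 ∧ M 3 = 2 ^ r ∧ M 4 = K * r ∧
      ∀ x, 5 ≤ x → M x = 0) ?_ ?_ fun r hr =>
      Runs.seq (mid := fun M => M 0 = n ∧ M 2 = n ^ 4 ∧ M 3 = 2 ^ (r + 1) ∧ M 4 = K * r ∧
        ∀ x, 5 ≤ x → M x = 0) (Runs.setVar hQ ?_) (Runs.setVar hQ ?_)) ?_ ?_
  · rintro M rfl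
    have h4 : n * n * n * n = n ^ 4 := by ring
    refine ⟨by simp [h4]; omega, by simp [Function.update], by simp [Function.update, h4],
      by simp [Function.update], fun x hx => ?_⟩
    rw [Function.update_of_ne (by omega), if_neg (by omega)]
  · rintro M ⟨h0, h2, h4, h5⟩
    refine ⟨by simp; omega, by simpa [Function.update], by simpa [Function.update],
      by simp [Function.update], by simpa [Function.update], fun x hx => ?_⟩
    rw [Function.update_of_ne (by omega), h5 x hx]
  · rintro r hr M ⟨h0, h2, h3, h4, h5⟩
    have := Nat.pow_lt_of_lt_clog hr
    simp [h0, h3, this]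
  · rintro M ⟨h0, h2, h3, h4, h5⟩
    have := Nat.le_pow_clog (b := 2) (by norm_num) n
    simp [h0, h3, this]
  · rintro M ⟨h0, h2, h3, h4, h5⟩
    have := Nat.pow_lt_of_lt_clog hr
    refine ⟨by simp [h3]; omega, by simpa [Function.update], by simpa [Function.update],
      by simp [Function.update, h3, pow_succ'], by simpa [Function.update], fun x hx => ?_⟩
    rw [Function.update_of_ne (by omega), h5 x hx]
  · rintro M ⟨h0, h2, h3, h4, h5⟩
    have : K * (r + 1) ≤ K * Nat.clog 2 n := Nat.mul_le_mul_left _ hr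
    refine ⟨by simp only [eval_add, eval_var, eval_lit, h4]; linarith, by simpa [Function.update],
      by simpa [Function.update], by simpa [Function.update], by simp [Function.update, h4]; ring,
      fun x hx => ?_⟩
    rw [Function.update_of_ne (by omega), h5 x hx]
  · rintro M ⟨h0, h2, h3, h4, h5⟩
    exact ⟨h0, h2, by simpa using h3, by simpa using h4, h5⟩
  · rintro M ⟨h0, h2, h3, h4, h5⟩
    exact ⟨h0, h2, h4, h5⟩

/-- The number of positive answers to test number `i` in the first `r` rounds. -/
noncomputable def positiveCount (H : Fin n → Halfspace) (err : ℕ × ℕ → Bool) (t r i : ℕ) : ℕ :=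
  ∑ r' ∈ Finset.range r,
    noisyBit (SideTest H (i / n / n / n) (i / n / n % n) (i / n % n) (i % n))
      (err (testTime t r', i))

lemma positiveCount_le (r i : ℕ) : positiveCount H err t r i ≤ r := by
  simpa [positiveCount] using Finset.sum_le_card_nsmul (Finset.range r) _ 1
    fun r' _ => noisyBit_le_one
    (SideTest H (i / n / n / n) (i / n / n % n) (i / n % n) (i % n)) (err (testTime t r', i))

/-- Entries `0` of arrays `2` and `3` are tracked because the later shifted writes skip them and the
prefix sums need a zero there. -/
lemma runs_vote {R : ℕ} (hQ : 1 ≤ Q) (hNQ : n ^ 4 ≤ Q) (hRW : R ≤ W) (hW : 1 ≤ W) :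
    Runs H W Q err vote t (voteTime R)
      (fun M => M 0 = n ∧ M 2 = n ^ 4 ∧ M 4 = R ∧ ∀ x, 5 ≤ x → M x = 0)
      (fun M => M 0 = n ∧ M 2 = n ^ 4 ∧ M 4 = R ∧ M (cell 2 0) = 0 ∧ M (cell 3 0) = 0 ∧
        ∀ i < n ^ 4, M (cell 1 i) = positiveCount H err t R i) := by
  refine Runs.mono (Runs.loop
    (Inv := fun r M => (M 0 = n ∧ M 2 = n ^ 4 ∧ M 4 = R ∧ M (cell 2 0) = 0 ∧ M (cell 3 0) = 0) ∧
        M 5 = r ∧ ∀ i < n ^ 4, M (cell 1 i) = positiveCount H err t r i)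
    ?_ ?_ fun r hr =>
      Runs.seq (mid := fun M => (M 0 = n ∧ M 2 = n ^ 4 ∧ M 4 = R ∧ M (cell 2 0) = 0 ∧
        M (cell 3 0) = 0) ∧ M 5 = r ∧ (∀ i < n ^ 4, M (cell 1 i) = positiveCount H err t r i) ∧
        ∀ i < n ^ 4, M (cell 1 i) + M (cell 0 i) = positiveCount H err t (r + 1) i)
        (Runs.test hW ?_) <|
      Runs.seq (mid := fun M => (M 0 = n ∧ M 2 = n ^ 4 ∧ M 4 = R ∧ M (cell 2 0) = 0 ∧
        M (cell 3 0) = 0) ∧ M 5 = r ∧ ∀ i < n ^ 4, M (cell 1 i) = positiveCount H err t (r + 1) i)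
        (Runs.fill ?_) (Runs.setVar hQ ?_)) ?_ ?_
  · rintro r hr M ⟨⟨h0, h2, h4, -⟩, h5, -⟩
    simp [h4, h5, hr]
  · rintro M ⟨⟨h0, h2, h4, -⟩, h5, -⟩
    simp [h4, h5]
  · rintro M ⟨⟨h0, h2, h4, h6, h7⟩, h5, h8⟩
    refine ⟨by simpa [h2], fun i _ j _ _ _ hij => by simpa [cell] using hij, ?_⟩
    rintro M' ⟨w1, w2⟩
    have hk : ∀ x, (∀ i, cell 0 i ≠ x) → M' x = M x := fun x hx => w2 x fun i _ _ => hx i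
    have hk' : ∀ q < 8, M' q = M q := fun q hq => hk q fun i => cell_ne hq _ _
    have hk'' : ∀ q x, q < 8 → q ≠ 0 → M' (cell q x) = M (cell q x) := fun q x h1 h2 =>
      hk _ fun i => by unfold cell; omega
    refine ⟨⟨by rw [hk' 0 (by omega), h0], by rw [hk' 2 (by omega), h2],
      by rw [hk' 4 (by omega), h4], by rw [hk'' _ _ (by omega) (by omega), h6],
      by rw [hk'' _ _ (by omega) (by omega), h7]⟩, by rw [hk' 5 (by omega), h5],
      fun i hi => by rw [hk'' _ _ (by omega) (by omega), h8 i hi], fun i hi => ?_⟩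
    have := w1 i (by simpa [h2] using hi) (by simp)
    simp only [eval_cellExpr, eval_pid, Matrix.cons_val, eval_div, eval_mod, eval_var, h0] at this
    rw [hk'' _ _ (by omega) (by omega), h8 i hi, this, positiveCount, positiveCount,
      Finset.sum_range_succ]
    -- The instant of the test in iteration `r`, as supplied by `Runs.loop`, is `testTime t r` by
    -- definition.
    rfl
  · rintro M ⟨⟨h0, h2, h4, h6, h7⟩, h5, h8, h9⟩
    refine ⟨by simpa [h2], fun i hi => ?_, fun M' w1 w2 => ?_⟩
    · rw [eval_var, h2] at hi
      have := positiveCount_le (H := H) (err := err) (t := t) (r + 1) i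
      simp only [eval_add, eval_entry, eval_pid, h9 i hi]
      omega
    have hk : ∀ x, (∀ i, cell 1 i ≠ x) → M' x = M x := fun x hx => w2 x fun i _ => hx _
    have hk' : ∀ q < 8, M' q = M q := fun q hq => hk q fun i => cell_ne hq _ _
    have hk'' : ∀ q x, q < 8 → q ≠ 1 → M' (cell q x) = M (cell q x) := fun q x h1 h2 =>
      hk _ fun i => by unfold cell; omega
    refine ⟨⟨by rw [hk' 0 (by omega), h0], by rw [hk' 2 (by omega), h2],
      by rw [hk' 4 (by omega), h4], by rw [hk'' _ _ (by omega) (by omega), h6],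
      by rw [hk'' _ _ (by omega) (by omega), h7]⟩, by rw [hk' 5 (by omega), h5], fun i hi => ?_⟩
    rw [← h9 i hi]
    exact w1 i (by simpa [h2] using hi)
  · rintro M ⟨⟨h0, h2, h4, h6, h7⟩, h5, h8⟩
    refine ⟨by simp [h5]; omega, ⟨by simpa [Function.update], by simpa [Function.update],
      by simpa [Function.update], by rwa [update_cell _ (by omega)],
      by rwa [update_cell _ (by omega)]⟩, by simp [h5],
      fun i hi => by rw [update_cell _ (by omega), h8 i hi]⟩
  · rintro M ⟨h0, h2, h4, h5⟩
    refine ⟨⟨h0, h2, h4, h5 _ (by simp [cell]), h5 _ (by simp [cell])⟩, h5 _ le_rfl, fun i _ => ?_⟩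
    rw [h5 _ (by unfold cell; omega)]
    simp [positiveCount]
  · rintro M ⟨⟨h0, h2, h4, h6, h7⟩, h5, h8⟩
    exact ⟨h0, h2, h4, h6, h7, h8⟩

open Classical in
/-- The number of tests with number less than `x` whose answer is positive. -/
noncomputable def testCount (H : Fin n → Halfspace) (x : ℕ) : ℕ :=
  Nat.count (fun i => SideTest H (i / n / n / n) (i / n / n % n) (i / n % n) (i % n)) x

/-- Here the error bits disappear: under `herr` every majority is the truth, stored as an increment
of `testCount`. -/
lemma runs_majority {t₀ R : ℕ} (hNQ : n ^ 4 ≤ Q) (hW : 1 ≤ W)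
    (herr : ∀ i < n ^ 4,
      2 * ((Finset.range R).filter fun r => err (testTime t₀ r, i) = true).card < R) :
    Runs H W Q err majority t majorityTime
      (fun M => M 0 = n ∧ M 2 = n ^ 4 ∧ M 4 = R ∧ M (cell 2 0) = 0 ∧ M (cell 3 0) = 0 ∧
        ∀ i < n ^ 4, M (cell 1 i) = positiveCount H err t₀ R i)
      (fun M => M 2 = n ^ 4 ∧ (M 0 = n ∧ M (cell 3 0) = 0) ∧
        ∀ x ≤ n ^ 4, M (cell 2 x) = testCount H x - testCount H (x - 1)) := by
  classical
  refine Runs.fill ?_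
  rintro M ⟨h0, h2, h4, h6, h7, h8⟩
  refine ⟨by simpa [h2], fun i hi => ?_, fun M' w1 w2 => ?_⟩
  · simp only [eval_less]
    split_ifs <;> omega
  have hk' : ∀ q < 8, M' q = M q := fun q hq => w2 q fun i _ => cell_ne hq _ _
  have hk'' : ∀ x, (∀ i, cell 2 (i + 1) ≠ x) → M' x = M x := fun x hx => w2 x fun i _ => hx _
  refine ⟨by rw [hk' 2 (by omega), h2], ⟨by rw [hk' 0 (by omega), h0], ?_⟩, fun x hx => ?_⟩
  · rw [hk'' _ fun i => by unfold cell; omega, h7]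
  · rcases Nat.eq_zero_or_pos x with rfl | hx0
    · rw [hk'' _ fun i => by unfold cell; omega, h6]
      simp
    · obtain ⟨i, rfl⟩ : ∃ i, x = i + 1 := ⟨x - 1, by omega⟩
      rw [w1 i (by simp [h2]; omega)]
      simp only [eval_less, eval_var, eval_mul, eval_ofNat, eval_entry, eval_pid, h4,
        h8 i (by omega)]
      have := lt_two_mul_sum_noisyBit_iff
        (SideTest H (i / n / n / n) (i / n / n % n) (i / n % n) (i % n))
        (fun r => err (testTime t₀ r, i)) R (herr i (by omega))
      rw [positiveCount]
      simp only [this]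
      simp [testCount, Nat.count_succ]

/-- Parallel prefix sums by doubling: after `j` iterations entry `x` holds the sum over the last `2
^ j` increments. `F` is any property that survives changes to cell `3` and to the positive entries
of array `r`. -/
lemma runs_prefixSum {r N : ℕ} {S : ℕ → ℕ} {F : (ℕ → ℕ) → Prop} (hQ : 1 ≤ Q)
    (hNQ : N ≤ Q) (hN : 1 ≤ N) (hNW : 2 * N ≤ W) (hS : Monotone S) (hS0 : S 0 = 0)
    (hSW : S N ≤ W)
    (hF : ∀ M M', (∀ x, x ≠ 3 → (∀ y, cell r (y + 1) ≠ x) → M' x = M x) → F M → F M') :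
    Runs H W Q err (prefixSum r) t (prefixSumTime r (Nat.clog 2 N))
      (fun M => M 2 = N ∧ F M ∧ ∀ x ≤ N, M (cell r x) = S x - S (x - 1))
      (fun M => M 2 = N ∧ F M ∧ ∀ x ≤ N, M (cell r x) = S x) := by
  have hF' : ∀ M v, F M → F (Function.update M 3 v) := fun M v =>
    hF _ _ fun x hx _ => Function.update_of_ne hx _ _
  refine Runs.seq (mid := fun M => M 2 = N ∧ F M ∧ M 3 = 1 ∧
      ∀ x ≤ N, M (cell r x) = S x - S (x - 1)) (Runs.setVar hQ ?_) <|
    Runs.mono (Runs.loop (Inv := fun j M => M 2 = N ∧ F M ∧ M 3 = 2 ^ j ∧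
      ∀ x ≤ N, M (cell r x) = S x - S (x - 2 ^ j)) ?_ ?_ fun j hj =>
      Runs.seq (mid := fun M => M 2 = N ∧ F M ∧ M 3 = 2 ^ j ∧
        ∀ x ≤ N, M (cell r x) = S x - S (x - 2 ^ (j + 1))) (Runs.fill ?_) (Runs.setVar hQ ?_)) ?_ ?_
  · rintro M ⟨h2, hFM, hx⟩
    refine ⟨by simp; omega, by simpa [Function.update], hF' _ _ hFM, by simp, fun x h => ?_⟩
    rw [update_cell _ (by omega), hx x h]
  · rintro j hj M ⟨h2, -, h3, -⟩
    have := Nat.pow_lt_of_lt_clog hj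
    simp [h2, h3, this]
  · rintro M ⟨h2, -, h3, -⟩
    have := Nat.le_pow_clog (b := 2) (by norm_num) N
    simp [h2, h3, this]
  · rintro M ⟨h2, hFM, h3, hx⟩
    -- Two adjacent windows of length `2 ^ j` are joined. Truncation sends indices below the left
    -- end to entry `0`, which is never written and holds zero.
    have hv : ∀ i < N, M (cell r (i + 1)) + M (cell r (i + 1 - 2 ^ j)) =
        S (i + 1) - S (i + 1 - 2 ^ (j + 1)) := by
      intro i hi
      have e1 := hx (i + 1) (by omega)
      have e2 := hx (i + 1 - 2 ^ j) (by omega)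
      have e3 : i + 1 - 2 ^ j - 2 ^ j = i + 1 - 2 ^ (j + 1) := by rw [pow_succ]; omega
      rw [e3] at e2
      have m1 := hS (show i + 1 - 2 ^ (j + 1) ≤ i + 1 - 2 ^ j by omega)
      have m2 := hS (show i + 1 - 2 ^ j ≤ i + 1 by omega)
      omega
    refine ⟨by simpa [h2], fun i hi => ?_, fun M' w1 w2 => ?_⟩
    · rw [eval_var, h2] at hi
      have := hS (show i + 1 ≤ N by omega)
      simp only [eval_add, eval_entry, eval_pid, eval_ofNat, eval_sub, eval_var, h3, hv i hi]
      omega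
    · refine ⟨?_, ?_, ?_, fun x hxN => ?_⟩
      · rw [w2 _ fun i _ => cell_ne (by omega) _ _, h2]
      · exact hF _ _ (fun x _ hx => w2 _ fun i _ => hx i) hFM
      · rw [w2 _ fun i _ => cell_ne (by omega) _ _, h3]
      · rcases Nat.eq_zero_or_pos x with rfl | hx0
        · rw [w2 _ fun i _ => by unfold cell; omega, hx _ hxN]
          simp
        · obtain ⟨i, rfl⟩ : ∃ i, x = i + 1 := ⟨x - 1, by omega⟩
          rw [w1 i (by simp [h2]; omega), ← hv i (by omega)]
          simp [h3]
  · rintro M ⟨h2, hFM, h3, hx⟩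
    have := Nat.pow_lt_of_lt_clog hj
    refine ⟨by simp [h3]; omega, by simpa [Function.update], hF' _ _ hFM,
      by simp [h3, pow_succ'], fun x h => ?_⟩
    rw [update_cell _ (by omega), hx x h]
  · rintro M ⟨h2, hFM, h3, hx⟩
    exact ⟨h2, hFM, by simpa using h3, by simpa using hx⟩
  · rintro M ⟨h2, hFM, h3, hx⟩
    refine ⟨h2, hFM, fun x h => ?_⟩
    have := Nat.le_pow_clog (b := 2) (by norm_num) N
    rw [hx x h, Nat.sub_eq_zero_of_le (h.trans this), hS0, Nat.sub_zero]

end phases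

end PRAM

/-! ### Listing the vertices and their neighbors -/

namespace PRAM

open PRAM.Expr

/-- First digit of the processor number, read as a three-digit number. -/
def digit₀ : Expr := .pid / var 0 / var 0

/-- Second digit of the processor number, read as a three-digit number. -/
def digit₁ : Expr := .pid / var 0 % var 0

/-- Third digit of the processor number. -/
def digit₂ : Expr := .pid % var 0

/-- Expression for `sortCode` of the processor number. -/
def sortCodeExpr : Expr :=
  ((digit₀ - (digit₀ - digit₂)) * var 0 +
    (digit₀ + digit₁ + digit₂ - (digit₀ - (digit₀ - digit₂)) - (digit₁ + (digit₂ - digit₁)))) *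
      var 0 + (digit₁ + (digit₂ - digit₁))

/-- Expression for `slot`. -/
def slotExpr (x : Expr) : Expr :=
  less (x / var 0 / var 0) (x % var 0) + less (x / var 0 % var 0) (x % var 0)

/-- Expression for the address of the list of vertices. -/
def baseExpr : Expr := 8 * var 2 + 16

/-- Array `4` receives the indicator of `IsEdgeEnd`. -/
def edgeEnds : Prog :=
  fill (var 2) 4 0 (less digit₀ digit₁ *
    equal (entry 2 (.pid * var 0 + var 0) - entry 2 (.pid * var 0)) (var 0))

/-- Array `3` receives the indicator of `IsVertexCode`, with a shift by one. -/
def vertexCodes : Prog := fill (var 2) 3 1 (less digit₁ digit₂ * entry 4 .pid)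

/-- Array `5` receives the vertex indices of the edge ends. -/
def ranks : Prog := .assign (var 2) (entry 4 .pid) (cellExpr 5 .pid) (entry 3 sortCodeExpr)

/-- All words of the list of vertices receive the number of vertices. -/
def clearList : Prog := .assign (6 * entry 3 (var 2)) 1 (baseExpr + .pid) (entry 3 (var 2))

/-- The planes through the vertices are written to the list. -/
def writeFacets : Prog :=
  .assign (var 2) (entry 4 .pid) (baseExpr + 6 * entry 5 .pid + slotExpr .pid) digit₂

/-- The code of the edge end with the same edge as the first three digits of the processor
number, and with the fourth digit as its endpoint. -/
def otherEnd : Expr := .pid / var 0 / var 0 * var 0 + .pid % var 0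

/-- The neighbors of the vertices are written to the list. -/
def writeNeighbors : Prog :=
  .assign (var 2)
    (entry 4 (.pid / var 0) * entry 4 otherEnd * (1 - equal (.pid / var 0 % var 0) (.pid % var 0)))
    (baseExpr + 6 * entry 5 (.pid / var 0) + 3 + slotExpr (.pid / var 0)) (entry 5 otherEnd)

/-- The number of vertices and the address of their list are written to cells `0` and `1`. -/
def finish : Prog := .seq (setVar 1 baseExpr) (setVar 0 (entry 3 (var 2)))

/-- The instructions that follow the computation of the vertex codes. -/
def output : Prog :=
  .seq ranks <| .seq clearList <| .seq writeFacets <| .seq writeNeighbors finish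

/-- Duration of `edgeEnds`. -/
def edgeEndsTime : ℕ :=
  fillTime (var 2) 4 0 (less digit₀ digit₁ *
    equal (entry 2 (.pid * var 0 + var 0) - entry 2 (.pid * var 0)) (var 0))

/-- Duration of `vertexCodes`. -/
def vertexCodesTime : ℕ := fillTime (var 2) 3 1 (less digit₁ digit₂ * entry 4 .pid)

/-! ### Correctness of the listing phases -/

section phases

variable {n : ℕ} {H : Fin n → Halfspace} {W Q : ℕ} {err : ℕ × ℕ → Bool} {t : ℕ}

/-- The planes `i`, `j`, `k` meet in a single point, which passes all sidedness tests. -/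
def PassesAllTests (H : Fin n → Halfspace) (i j k : ℕ) : Prop := ∀ l < n, SideTest H i j k l

/-- The `n` tests of the triple encoded by `x` are numbered consecutively from `x * n`; the count
rises by `n` exactly when all of them succeed. -/
lemma testCount_sub_eq_iff (x : ℕ) :
    testCount H (x * n + n) - testCount H (x * n) = n ↔
      PassesAllTests H (x / n / n) (x / n % n) (x % n) := by
  classical
  rw [testCount, testCount, Nat.count_add, Nat.add_sub_cancel_left, Nat.count_iff_forall]
  refine forall₂_congr fun l hl => ?_
  rw [mul_add_div_self hl, mul_add_mod_self hl]

lemma not_digit_lt_of_le (hn : 0 < n) {x : ℕ} (hx : n ^ 3 ≤ x) :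
    ¬ x / n / n < x / n % n := by
  have h1 : n ≤ x / n / n := by
    rw [Nat.le_div_iff_mul_le hn, Nat.le_div_iff_mul_le hn]
    calc n * n * n = n ^ 3 := by ring
      _ ≤ x := hx
  have := Nat.mod_lt (x / n) hn
  omega

open Classical in
lemma runs_edgeEnds (hn : 0 < n) (hNQ : n ^ 4 ≤ Q) (hW : 1 ≤ W) :
    Runs H W Q err edgeEnds t edgeEndsTime
      (fun M => M 2 = n ^ 4 ∧ (M 0 = n ∧ M (cell 3 0) = 0) ∧
        ∀ x ≤ n ^ 4, M (cell 2 x) = testCount H x)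
      (fun M => M 2 = n ^ 4 ∧ M 0 = n ∧ M (cell 3 0) = 0 ∧
        ∀ x < n ^ 4, M (cell 4 x) = if IsEdgeEnd n (PassesAllTests H) x then 1 else 0) := by
  refine Runs.fill ?_
  rintro M ⟨h2, ⟨h0, h3⟩, hA⟩
  have hv : ∀ x < n ^ 4, (less digit₀ digit₁ *
      equal (entry 2 (.pid * var 0 + var 0) - entry 2 (.pid * var 0)) (var 0)).eval M x =
      if IsEdgeEnd n (PassesAllTests H) x then 1 else 0 := by
    intro x _
    simp only [eval_mul, eval_less, digit₀, digit₁, eval_div, eval_mod, eval_pid, eval_var, h0,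
      eval_equal, eval_sub, eval_entry, eval_add, IsEdgeEnd]
    -- Numbers from `n ^ 3` on have a leading part of at least `n` and fail this comparison. For
    -- them array `2` may be read out of range, but the product is zero anyway.
    by_cases hlt : x / n / n < x / n % n
    · have hx : x < n ^ 3 := by
        by_contra! hc
        exact not_digit_lt_of_le hn hc hlt
      have hle : x * n + n ≤ n ^ 4 := by
        calc x * n + n = (x + 1) * n := by ring
          _ ≤ n ^ 3 * n := Nat.mul_le_mul_right _ hx
          _ = n ^ 4 := by ring
      rw [hA _ hle, hA _ (by omega)]
      simp [hlt, testCount_sub_eq_iff]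
    · simp [hlt]
  refine ⟨by simpa [h2], fun i hi => ?_, fun M' w1 w2 => ?_⟩
  · rw [eval_var, h2] at hi
    rw [hv i hi]
    split_ifs <;> omega
  · refine ⟨?_, ?_, ?_, fun x hx => ?_⟩
    · rw [w2 _ fun i _ => cell_ne (by omega) _ _, h2]
    · rw [w2 _ fun i _ => cell_ne (by omega) _ _, h0]
    · rw [w2 _ fun i _ => by unfold cell; omega, h3]
    · rw [← hv x hx]
      exact w1 x (by simpa [h2] using hx)

open Classical in
lemma runs_vertexCodes (hNQ : n ^ 4 ≤ Q) (hW : 1 ≤ W) :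
    Runs H W Q err vertexCodes t vertexCodesTime
      (fun M => M 2 = n ^ 4 ∧ M 0 = n ∧ M (cell 3 0) = 0 ∧
        ∀ x < n ^ 4, M (cell 4 x) = if IsEdgeEnd n (PassesAllTests H) x then 1 else 0)
      (fun M => M 2 = n ^ 4 ∧ (M 0 = n ∧
        ∀ x < n ^ 4, M (cell 4 x) = if IsEdgeEnd n (PassesAllTests H) x then 1 else 0) ∧
        ∀ x ≤ n ^ 4, M (cell 3 x) = codeCount n (PassesAllTests H) x -
          codeCount n (PassesAllTests H) (x - 1)) := by
  refine Runs.fill ?_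
  rintro M ⟨h2, h0, h3, h4⟩
  have hv : ∀ x < n ^ 4, (less digit₁ digit₂ * entry 4 .pid).eval M x =
      if IsVertexCode n (PassesAllTests H) x then 1 else 0 := by
    intro x hx
    simp only [eval_mul, eval_less, digit₂, digit₁, eval_div, eval_mod, eval_pid, eval_var, h0,
      eval_entry, h4 x hx, IsVertexCode]
    by_cases hlt : x / n % n < x % n <;> simp [hlt]
  refine ⟨by simpa [h2], fun i hi => ?_, fun M' w1 w2 => ?_⟩
  · rw [eval_var, h2] at hi
    rw [hv i hi]
    split_ifs <;> omega
  · refine ⟨?_, ⟨?_, fun x hx => ?_⟩, fun x hx => ?_⟩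
    · rw [w2 _ fun i _ => cell_ne (by omega) _ _, h2]
    · rw [w2 _ fun i _ => cell_ne (by omega) _ _, h0]
    · rw [w2 _ fun i _ => by unfold cell; omega, h4 x hx]
    · rcases Nat.eq_zero_or_pos x with rfl | hx0
      · rw [w2 _ fun i _ => by unfold cell; omega, h3]
        simp
      · obtain ⟨i, rfl⟩ : ∃ i, x = i + 1 := ⟨x - 1, by omega⟩
        rw [w1 i (by simp [h2]; omega), hv i (by omega)]
        simp [codeCount, Nat.count_succ]

/-- Address of the list of vertices. -/
def listBase (n : ℕ) : ℕ := 8 * n ^ 4 + 16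

/-- The last array cell is at `8 * n ^ 4 + 15`, whence the offset `16`; writing the list leaves all
arrays intact. -/
lemma cell_lt_listBase {r x : ℕ} (hr : r < 8) (hx : x ≤ n ^ 4) : cell r x < listBase n := by
  unfold cell listBase
  omega

open Classical in
/-- The content of the memory from which the list of vertices is written. -/
structure Prepared (n : ℕ) (Good : ℕ → ℕ → ℕ → Prop) (M : ℕ → ℕ) : Prop where
  size : M 0 = n
  pow : M 2 = n ^ 4
  count : M (cell 3 (n ^ 4)) = codeCount n Good (n ^ 3)
  edgeEnd : ∀ x < n ^ 4, M (cell 4 x) = if IsEdgeEnd n Good x then 1 else 0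
  rank : ∀ x < n ^ 4, IsEdgeEnd n Good x → M (cell 5 x) = rank n Good x

variable {Good : ℕ → ℕ → ℕ → Prop}

lemma Prepared.congr {M M' : ℕ → ℕ} (h : Prepared n Good M) (hM : ∀ x < listBase n, M' x = M x) :
    Prepared n Good M' where
  size := by rw [hM _ (by unfold listBase; omega), h.size]
  pow := by rw [hM _ (by unfold listBase; omega), h.pow]
  count := by rw [hM _ (cell_lt_listBase (by omega) le_rfl), h.count]
  edgeEnd x hx := by rw [hM _ (cell_lt_listBase (by omega) hx.le), h.edgeEnd x hx]
  rank x hx hE := by rw [hM _ (cell_lt_listBase (by omega) hx.le), h.rank x hx hE]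

lemma Prepared.edgeEnd_ne_zero_iff {M : ℕ → ℕ} (h : Prepared n Good M) {x : ℕ} (hx : x < n ^ 4) :
    M (cell 4 x) ≠ 0 ↔ IsEdgeEnd n Good x := by
  rw [h.edgeEnd x hx]
  simp

lemma Prepared.eval_baseExpr {M : ℕ → ℕ} (h : Prepared n Good M) (i : ℕ) :
    baseExpr.eval M i = listBase n := by
  simp [baseExpr, listBase, h.pow]

lemma Prepared.eval_slotExpr {M : ℕ → ℕ} (h : Prepared n Good M) (i : ℕ) (x : Expr) :
    (slotExpr x).eval M i = slot n (x.eval M i) := by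
  simp [slotExpr, slot, h.size]

lemma eval_sortCodeExpr {M : ℕ → ℕ} (h : M 0 = n) (i : ℕ) :
    sortCodeExpr.eval M i = sortCode n i := by
  simp only [sortCodeExpr, digit₀, digit₁, digit₂, eval_add, eval_mul, eval_sub, eval_div,
    eval_mod, eval_pid, eval_var, h]
  rfl

lemma IsEdgeEnd.lt_pow_four (hG : IsVertexRelation n Good) (hn : 0 < n) {x : ℕ}
    (hx : IsEdgeEnd n Good x) : x < n ^ 4 :=
  (hx.lt hG).trans_le (Nat.pow_le_pow_right hn (by norm_num))

open Classical in
lemma runs_ranks (hG : IsVertexRelation n Good) (hn : 0 < n) (hNQ : n ^ 4 ≤ Q) (hW : n ^ 4 ≤ W) :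
    Runs H W Q err ranks t ((var 2).size + (entry 4 .pid).size + (cellExpr 5 .pid).size +
        (entry 3 sortCodeExpr).size)
      (fun M => M 2 = n ^ 4 ∧ (M 0 = n ∧
        ∀ x < n ^ 4, M (cell 4 x) = if IsEdgeEnd n Good x then 1 else 0) ∧
        ∀ x ≤ n ^ 4, M (cell 3 x) = codeCount n Good x)
      (Prepared n Good) := by
  have h34 : n ^ 3 ≤ n ^ 4 := Nat.pow_le_pow_right hn (by norm_num)
  refine Runs.assign ?_
  rintro M ⟨h2, ⟨h0, h4⟩, h3⟩
  have hv : ∀ x < n ^ 4, M (cell 4 x) ≠ 0 → (entry 3 sortCodeExpr).eval M x = rank n Good x := by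
    intro x hx hE
    have hE' : IsEdgeEnd n Good x := by simpa [h4 x hx] using hE
    have := hE'.sortCode_lt hG
    rw [eval_entry, eval_sortCodeExpr h0, h3 _ (by omega)]
    rfl
  refine ⟨by simpa [h2], fun i _ j _ _ _ hij => by simpa [cell] using hij, fun i hi hg => ?_, ?_⟩
  · rw [eval_var, h2] at hi
    have hE' : IsEdgeEnd n Good i := by simpa [h4 i hi] using hg
    rw [hv i hi hg]
    have h1 := hE'.rank_lt hG
    have h2 := codeCount_le (Good := Good) (n := n) (n ^ 3)
    omega
  · rintro M' ⟨w1, w2⟩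
    simp only [eval_var, h2, eval_entry, eval_cellExpr, eval_pid] at w1 w2
    refine ⟨?_, ?_, ?_, fun x hx => ?_, fun x hx hE => ?_⟩
    · rw [w2 _ fun i _ _ => cell_ne (by omega) _ _, h0]
    · rw [w2 _ fun i _ _ => cell_ne (by omega) _ _, h2]
    · rw [w2 _ fun i _ _ => by unfold cell; omega, h3 _ le_rfl, codeCount_eq_of_le hG h34]
    · rw [w2 _ fun i _ _ => by unfold cell; omega, h4 x hx]
    · have hg : M (cell 4 x) ≠ 0 := by simpa [h4 x hx] using hE
      rw [w1 x hx hg]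
      exact hv x hx hg

/-- The number of vertices is the word for a missing neighbor. Once it is the default value, rays
need no detection: their words are simply never overwritten. -/
lemma runs_clearList (hn : 0 < n) (hNQ : 6 * n ^ 4 ≤ Q) (hW : n ^ 4 ≤ W) :
    Runs H W Q err clearList t ((6 * entry 3 (var 2)).size + (1 : Expr).size +
        (baseExpr + .pid).size + (entry 3 (var 2)).size)
      (Prepared n Good)
      (fun M => Prepared n Good M ∧ ∀ z < 6 * codeCount n Good (n ^ 3),
        M (listBase n + z) = codeCount n Good (n ^ 3)) := by
  refine Runs.assign ?_
  intro M h
  have h34 : n ^ 3 ≤ n ^ 4 := Nat.pow_le_pow_right hn (by norm_num)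
  have hle := codeCount_le (Good := Good) (n := n) (n ^ 3)
  have hm : (6 * entry 3 (var 2)).eval M 0 = 6 * codeCount n Good (n ^ 3) := by
    simp [h.pow, h.count]
  have hv : ∀ i, (entry 3 (var 2)).eval M i = codeCount n Good (n ^ 3) := by
    simp [h.pow, h.count]
  have ha : ∀ i, (baseExpr + .pid).eval M i = listBase n + i := by
    simp [h.eval_baseExpr]
  refine ⟨by rw [hm]; omega, fun i _ j _ _ _ hij => ?_, fun i _ _ => by rw [hv]; omega, ?_⟩
  · rw [ha, ha] at hij
    omega
  · rintro M' ⟨w1, w2⟩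
    simp only [hm, hv, ha] at w1 w2
    exact ⟨h.congr fun x hx => w2 x fun i _ _ => by omega, fun z hz => w1 z hz (by simp)⟩

lemma runs_writeFacets (hG : IsVertexRelation n Good) (hn : 0 < n) (hNQ : n ^ 4 ≤ Q)
    (hW : n ≤ W) :
    Runs H W Q err writeFacets t ((var 2).size + (entry 4 .pid).size +
        (baseExpr + 6 * entry 5 .pid + slotExpr .pid).size + digit₂.size)
      (fun M => Prepared n Good M ∧ ∀ z < 6 * codeCount n Good (n ^ 3),
        M (listBase n + z) = codeCount n Good (n ^ 3))
      (fun M => Prepared n Good M ∧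
        (∀ x, IsEdgeEnd n Good x → M (listBase n + 6 * rank n Good x + slot n x) = x % n) ∧
        ∀ x, IsEdgeEnd n Good x →
          M (listBase n + 6 * rank n Good x + 3 + slot n x) = codeCount n Good (n ^ 3)) := by
  refine Runs.assign ?_
  rintro M ⟨h, hz⟩
  have hm : (var 2).eval M 0 = n ^ 4 := h.pow
  have hg : ∀ i < n ^ 4, (entry 4 .pid).eval M i ≠ 0 ↔ IsEdgeEnd n Good i := fun i hi =>
    h.edgeEnd_ne_zero_iff hi
  have ha : ∀ i < n ^ 4, IsEdgeEnd n Good i →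
      (baseExpr + 6 * entry 5 .pid + slotExpr .pid).eval M i =
        listBase n + 6 * rank n Good i + slot n i := fun i hi hE => by
    simp [h.eval_baseExpr, h.eval_slotExpr, h.rank i hi hE]
  have hv : ∀ i, digit₂.eval M i = i % n := by simp [digit₂, h.size]
  rw [hm]
  refine ⟨hNQ, fun i hi j hj gi gj hij => ?_, fun i _ _ => ?_, ?_⟩
  · rw [hg i hi] at gi
    rw [hg j hj] at gj
    rw [ha i hi gi, ha j hj gj] at hij
    have := slot_lt n i
    have := slot_lt n j
    exact gi.eq_of_rank_eq hG gj (by omega) (by omega)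
  · rw [hv]
    exact (Nat.mod_lt _ hn).le.trans hW
  · rintro M' ⟨w1, w2⟩
    beta_reduce at w1 w2
    refine ⟨h.congr fun x hx => w2 x fun i hi gi => ?_, fun x hE => ?_, fun x hE => ?_⟩
    · rw [ha i hi ((hg i hi).1 gi)]
      omega
    · have hx := hE.lt_pow_four hG hn
      rw [← ha x hx hE]
      exact (w1 x hx ((hg x hx).2 hE)).trans (hv x)
    · have hr := hE.rank_lt hG
      have hs := slot_lt n x
      -- Facets occupy offsets `0` to `2` of a record and neighbors `3` to `5`, so the defaults for
      -- the neighbors survive.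
      rw [w2 _ fun i hi gi => ?_, add_assoc, add_assoc, hz _ (by omega)]
      rw [ha i hi ((hg i hi).1 gi)]
      have := slot_lt n i
      omega

/-- The list of vertices is stored at address `listBase n`. -/
structure Listed (n : ℕ) (Good : ℕ → ℕ → ℕ → Prop) (M : ℕ → ℕ) : Prop where
  facet : ∀ x, IsEdgeEnd n Good x → M (listBase n + 6 * rank n Good x + slot n x) = x % n
  neighbor : ∀ x l, IsEdgeEnd n Good x → l < n → l ≠ x % n → IsEdgeEnd n Good (x / n * n + l) →
    M (listBase n + 6 * rank n Good x + 3 + slot n x) = rank n Good (x / n * n + l)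
  no_neighbor : ∀ x, IsEdgeEnd n Good x →
    (∀ l < n, l ≠ x % n → ¬ IsEdgeEnd n Good (x / n * n + l)) →
    M (listBase n + 6 * rank n Good x + 3 + slot n x) = codeCount n Good (n ^ 3)

/-- Processor `y` pairs the edge end `y / n` with the candidate `y % n` for the opposite endpoint.
The target word determines the edge end, and `IsVertexRelation.unique` the candidate, so the writes
are exclusive. -/
lemma runs_writeNeighbors (hG : IsVertexRelation n Good) (hn : 0 < n) (hNQ : n ^ 4 ≤ Q)
    (hW : n ^ 4 ≤ W) :
    Runs H W Q err writeNeighbors t ((var 2).size +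
        (entry 4 (.pid / var 0) * entry 4 otherEnd *
          (1 - equal (.pid / var 0 % var 0) (.pid % var 0))).size +
        (baseExpr + 6 * entry 5 (.pid / var 0) + 3 + slotExpr (.pid / var 0)).size +
        (entry 5 otherEnd).size)
      (fun M => Prepared n Good M ∧
        (∀ x, IsEdgeEnd n Good x → M (listBase n + 6 * rank n Good x + slot n x) = x % n) ∧
        ∀ x, IsEdgeEnd n Good x →
          M (listBase n + 6 * rank n Good x + 3 + slot n x) = codeCount n Good (n ^ 3))
      (fun M => Prepared n Good M ∧ Listed n Good M) := by
  refine Runs.assign ?_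
  rintro M ⟨h, hf, hz⟩
  have hm : (var 2).eval M 0 = n ^ 4 := h.pow
  have hlt : ∀ y < n ^ 4, y / n < n ^ 4 := fun y hy => (Nat.div_le_self _ _).trans_lt hy
  have ho : ∀ y < n ^ 4, y / n / n * n + y % n < n ^ 4 := fun y hy => by
    have h1 : y / n / n * n ≤ y / n * n := Nat.mul_le_mul_right _ (Nat.div_le_self _ _)
    have h2 := Nat.div_add_mod' y n
    omega
  have hg : ∀ y < n ^ 4, (entry 4 (.pid / var 0) * entry 4 otherEnd *
      (1 - equal (.pid / var 0 % var 0) (.pid % var 0))).eval M y ≠ 0 ↔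
      IsEdgeEnd n Good (y / n) ∧ IsEdgeEnd n Good (y / n / n * n + y % n) ∧
        y % n ≠ y / n % n := by
    intro y hy
    rw [← h.edgeEnd_ne_zero_iff (hlt y hy), ← h.edgeEnd_ne_zero_iff (ho y hy)]
    simp only [eval_mul, eval_entry, otherEnd, eval_sub, eval_equal, eval_add, eval_div, eval_mod,
      eval_pid, eval_var, h.size, eval_ofNat, mul_ne_zero_iff, and_assoc]
    refine and_congr_right fun _ => and_congr_right fun _ => ?_
    by_cases e : y / n % n = y % n
    · simp [e]
    · simp [e, Ne.symm e]
  have ha : ∀ y < n ^ 4, IsEdgeEnd n Good (y / n) →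
      (baseExpr + 6 * entry 5 (.pid / var 0) + 3 + slotExpr (.pid / var 0)).eval M y =
        listBase n + 6 * rank n Good (y / n) + 3 + slot n (y / n) := fun y hy hE => by
    simp [h.eval_baseExpr, h.eval_slotExpr, h.size, h.rank _ (hlt y hy) hE]
  have hv : ∀ y < n ^ 4, IsEdgeEnd n Good (y / n / n * n + y % n) →
      (entry 5 otherEnd).eval M y = rank n Good (y / n / n * n + y % n) := fun y hy hE => by
    simp [otherEnd, h.size, h.rank _ (ho y hy) hE]
  have hd : ∀ x l, l < n → IsEdgeEnd n Good (x / n * n + l) → Good (x / n / n) (x / n % n) l := by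
    intro x l hl hE
    have := hE.2
    rwa [mul_add_div_self hl, mul_add_mod_self hl] at this
  rw [hm]
  refine ⟨hNQ, fun y hy y' hy' gy gy' hyy => ?_, fun y hy gy => ?_, ?_⟩
  · obtain ⟨E1, E2, ne⟩ := (hg y hy).1 gy
    obtain ⟨E1', E2', ne'⟩ := (hg y' hy').1 gy'
    rw [ha y hy E1, ha y' hy' E1'] at hyy
    have := slot_lt n (y / n)
    have := slot_lt n (y' / n)
    have hx : y / n = y' / n := E1.eq_of_rank_eq hG E1' (by omega) (by omega)
    have g2 := hd _ _ (Nat.mod_lt _ hn) E2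
    have g2' := hd _ _ (Nat.mod_lt _ hn) E2'
    rw [← hx] at g2' ne'
    have := hG.unique E1.2 g2 g2' ne ne'
    rw [← Nat.div_add_mod' y n, ← Nat.div_add_mod' y' n, hx, this]
  · obtain ⟨E1, E2, -⟩ := (hg y hy).1 gy
    rw [hv y hy E2]
    have h1 := E2.rank_lt hG
    have h2 := codeCount_le (Good := Good) (n := n) (n ^ 3)
    have h34 : n ^ 3 ≤ n ^ 4 := Nat.pow_le_pow_right hn (by norm_num)
    omega
  · rintro M' ⟨w1, w2⟩
    beta_reduce at w1 w2
    refine ⟨h.congr fun x hx => w2 x fun y hy gy => ?_, fun x hE => ?_, fun x l hE hl hne hE' => ?_,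
      fun x hE hno => ?_⟩
    · rw [ha y hy ((hg y hy).1 gy).1]
      omega
    · rw [w2 _ fun y hy gy => ?_, hf x hE]
      rw [ha y hy ((hg y hy).1 gy).1]
      have := slot_lt n x
      have := slot_lt n (y / n)
      omega
    · have hx := hE.lt hG
      have e1 : (x * n + l) / n = x := mul_add_div_self hl
      have e2 : (x * n + l) % n = l := mul_add_mod_self hl
      have hy : x * n + l < n ^ 4 := by
        calc x * n + l < (x + 1) * n := by linarith
          _ ≤ n ^ 3 * n := Nat.mul_le_mul_right _ hx
          _ = n ^ 4 := by ring
      have g := (hg _ hy).2 (by rw [e1, e2]; exact ⟨hE, hE', hne⟩)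
      have := w1 _ hy g
      rw [ha _ hy (by rwa [e1]), hv _ hy (by rwa [e1, e2]), e1, e2] at this
      exact this
    · rw [w2 _ fun y hy gy => ?_, hz x hE]
      obtain ⟨E1, E2, ne⟩ := (hg y hy).1 gy
      rw [ha y hy E1]
      intro heq
      have := slot_lt n x
      have := slot_lt n (y / n)
      have hx : y / n = x := E1.eq_of_rank_eq hG hE (by omega) (by omega)
      rw [hx] at E2 ne
      exact hno _ (Nat.mod_lt _ hn) ne E2

/-- Overwriting cells `0` and `1` destroys `n` but not `Listed`, which concerns only addresses from
`listBase n` on. -/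
lemma runs_finish (hn : 0 < n) (hQ : 1 ≤ Q) (hW : listBase n ≤ W) :
    Runs H W Q err finish t (setVarTime baseExpr + setVarTime (entry 3 (var 2)))
      (fun M => Prepared n Good M ∧ Listed n Good M)
      (fun M => M 0 = codeCount n Good (n ^ 3) ∧ M 1 = listBase n ∧ Listed n Good M) := by
  have hL : ∀ {M M' : ℕ → ℕ}, Listed n Good M → (∀ x, 2 ≤ x → M' x = M x) → Listed n Good M' := by
    intro M M' h hM
    have hb : 2 ≤ listBase n := by unfold listBase; omega
    exact ⟨fun x hE => by rw [hM _ (by omega), h.facet x hE],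
      fun x l hE hl hne hE' => by rw [hM _ (by omega), h.neighbor x l hE hl hne hE'],
      fun x hE hno => by rw [hM _ (by omega), h.no_neighbor x hE hno]⟩
  refine Runs.seq (mid := fun M => M 2 = n ^ 4 ∧ M (cell 3 (n ^ 4)) = codeCount n Good (n ^ 3) ∧
    M 1 = listBase n ∧ Listed n Good M) (Runs.setVar hQ ?_) (Runs.setVar hQ ?_)
  · rintro M ⟨h, h'⟩
    rw [h.eval_baseExpr]
    refine ⟨hW, by simpa [Function.update] using h.pow, ?_, by simp,
      hL h' fun x hx => Function.update_of_ne (by omega) _ _⟩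
    rw [update_cell _ (by omega), h.count]
  · rintro M ⟨h2, h3, h1, h'⟩
    have h34 : n ^ 3 ≤ n ^ 4 := Nat.pow_le_pow_right hn (by norm_num)
    have hle := codeCount_le (Good := Good) (n := n) (n ^ 3)
    have hv : (entry 3 (var 2)).eval M 0 = codeCount n Good (n ^ 3) := by simp [h2, h3]
    rw [hv]
    refine ⟨?_, by simp, by simpa [Function.update] using h1,
      hL h' fun x hx => Function.update_of_ne (by omega) _ _⟩
    unfold listBase at hW
    omega

open Classical in
lemma exists_runs_output : ∃ δ : ℕ, ∀ {n : ℕ} {Good : ℕ → ℕ → ℕ → Prop} {H : Fin n → Halfspace}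
    {W Q : ℕ} {err : ℕ × ℕ → Bool} {t : ℕ}, IsVertexRelation n Good → 0 < n → 6 * n ^ 4 ≤ Q →
    listBase n ≤ W → Runs H W Q err output t δ
      (fun M => M 2 = n ^ 4 ∧ (M 0 = n ∧
        ∀ x < n ^ 4, M (cell 4 x) = if IsEdgeEnd n Good x then 1 else 0) ∧
        ∀ x ≤ n ^ 4, M (cell 3 x) = codeCount n Good x)
      (fun M => M 0 = codeCount n Good (n ^ 3) ∧ M 1 = listBase n ∧ Listed n Good M) := by
  -- The duration is a metavariable, filled by unification with the sum of the phase durations. It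
  -- is created before `n` is introduced and so cannot depend on it.
  apply Exists.intro
  intro n Good H W Q err t hG hn hQ hW
  have h1 : n ≤ n ^ 4 := Nat.le_self_pow (by norm_num) n
  have hW' : n ^ 4 ≤ W := by unfold listBase at hW; omega
  exact Runs.seq (runs_ranks hG hn (by omega) hW') <|
    Runs.seq (runs_clearList hn hQ hW') <|
    Runs.seq (runs_writeFacets hG hn (by omega) (by omega)) <|
    Runs.seq (runs_writeNeighbors hG hn (by omega) hW') (runs_finish hn (by omega) hW)

end phases

end PRAM

/-! ### The list of vertices describes the intersection -/

namespace PRAM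

open Halfspace

section adjacency

variable {n : ℕ} {H : Fin n → Halfspace}

/-- Every test also asserts that the three planes meet in one point. As `n > 0`, one test supplies
this point, and its uniqueness makes all tests speak about the same one. -/
lemma passesAllTests_iff (hn : 0 < n) {i j k : ℕ} :
    PassesAllTests H i j k ↔ ∃ i' j' k' : Fin n, (i' : ℕ) = i ∧ (j' : ℕ) = j ∧ (k' : ℕ) = k ∧
      ∃ x, IsVertexOf H i' j' k' x := by
  constructor
  · intro h
    obtain ⟨i', j', k', -, rfl, rfl, rfl, -, x, hx, -⟩ := h 0 hn
    refine ⟨i', j', k', rfl, rfl, rfl, x, hx, mem_inter_iff.2 fun l => ?_⟩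
    obtain ⟨i₁, j₁, k₁, l₁, hi, hj, hk, hl, y, hy, hyl⟩ := h l l.2
    rw [Fin.val_inj] at hi hj hk hl
    subst hi hj hk hl
    rw [hx, Set.singleton_eq_singleton_iff] at hy
    subst hy
    exact hyl
  · rintro ⟨i', j', k', rfl, rfl, rfl, x, hx, hP⟩ l hl
    exact ⟨i', j', k', ⟨l, hl⟩, rfl, rfl, rfl, rfl, x, hx, mem_inter_iff.1 hP _⟩

lemma passesAllTests_of_isVertexOf {i j k : Fin n} {x : EuclideanSpace ℝ (Fin 3)}
    (h : IsVertexOf H i j k x) : PassesAllTests H i j k :=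
  (passesAllTests_iff i.pos).2 ⟨i, j, k, rfl, rfl, rfl, x, h⟩

/-- The interface between geometry and the program; its substantial field is `unique`, which comes
from `neighbor_unique`. -/
lemma isVertexRelation_passesAllTests (hn : 0 < n) (hH : InGeneralPosition H) :
    IsVertexRelation n (PassesAllTests H) where
  lt h := by
    obtain ⟨i, j, k, rfl, rfl, rfl, -⟩ := (passesAllTests_iff hn).1 h
    exact k.2
  swap_left h := by
    obtain ⟨i, j, k, rfl, rfl, rfl, x, hx⟩ := (passesAllTests_iff hn).1 h
    exact passesAllTests_of_isVertexOf hx.swap_left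
  swap_right h := by
    obtain ⟨i, j, k, rfl, rfl, rfl, x, hx⟩ := (passesAllTests_iff hn).1 h
    exact passesAllTests_of_isVertexOf hx.swap_right
  ne h := by
    obtain ⟨i, j, k, rfl, rfl, rfl, x, hx⟩ := (passesAllTests_iff hn).1 h
    exact fun e => hx.ne_right (Fin.ext e)
  unique h₁ h₂ h₃ hl hm := by
    obtain ⟨i, j, k, rfl, rfl, rfl, x, hx⟩ := (passesAllTests_iff hn).1 h₁
    obtain ⟨i₂, j₂, l, hi, hj, rfl, y, hy⟩ := (passesAllTests_iff hn).1 h₂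
    obtain ⟨i₃, j₃, m, hi', hj', rfl, z, hz⟩ := (passesAllTests_iff hn).1 h₃
    rw [Fin.val_inj] at hi hj hi' hj'
    subst hi hj hi' hj'
    exact congrArg Fin.val
      (hx.neighbor_unique hH hy hz (fun e => hl (e ▸ rfl)) fun e => hm (e ▸ rfl))

/-- Equal sorted codes mean the same set of planes, so `y` lies on `i`, `j` and `k`, which meet only
in `x`. -/
lemma eq_of_sortCode_eq {i j k u v e : Fin n} {x y : EuclideanSpace ℝ (Fin 3)}
    (hx : IsVertexOf H i j k x) (hy : IsVertexOf H u v e y) (huv : u < v)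
    (h : sortCode n (encode n u v e) = encode n i j k) : x = y := by
  have hlt : (u : ℕ) < v := huv
  have h1 : (v : ℕ) ≠ e := fun h => hy.ne_right (Fin.ext h)
  have h2 : (u : ℕ) ≠ e := fun h => hy.swap_left.ne_right (Fin.ext h)
  have := v.2
  have := e.2
  rw [sortCode_encode v.2 e.2] at h
  obtain ⟨e1, e2, e3⟩ := encode_inj (by omega) (by omega) j.2 k.2 h
  obtain ⟨yu, yv, ye⟩ := hy.mem_planes
  have key : ∀ w : Fin n, (w : ℕ) = u ∨ (w : ℕ) = v ∨ (w : ℕ) = e → y ∈ (H w).plane := by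
    rintro w (hw | hw | hw) <;> rw [Fin.val_inj] at hw <;> subst hw <;> assumption
  have hmem : y ∈ (H i).plane ∩ (H j).plane ∩ (H k).plane :=
    ⟨⟨key i (by omega), key j (by omega)⟩, key k (by omega)⟩
  rw [hx.1] at hmem
  exact hmem.symm

lemma exists_edge {i j k : Fin n} {x : EuclideanSpace ℝ (Fin 3)} (hH : InGeneralPosition H)
    (hij : i < j) (hjk : j < k) (hx : IsVertexOf H i j k x) (s : Fin 3) :
    ∃ u v : Fin n, u < v ∧ IsVertexOf H u v (![i, j, k] s) x ∧
      rank n (PassesAllTests H) (encode n u v (![i, j, k] s)) =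
        codeCount n (PassesAllTests H) (encode n i j k) ∧
      slot n (encode n u v (![i, j, k] s)) = s ∧
      ∀ w, (w = u ∨ w = v) ↔ ∃ s', s' ≠ s ∧ w = ![i, j, k] s' := by
  have hG := isVertexRelation_passesAllTests i.pos hH
  have hval : ∀ s, ((![i, j, k] s : Fin n) : ℕ) = ![(i : ℕ), j, k] s := by
    intro s
    fin_cases s <;> rfl
  obtain ⟨u, v, hE, h1, h2, huv, hv, h3⟩ :=
    exists_isEdgeEnd hG hij hjk (passesAllTests_of_isVertexOf hx) s
  rw [← hval] at hE h1 h2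
  have hgood := hE.2
  rw [encode_div_div hv (Fin.is_lt _), encode_div_mod hv (Fin.is_lt _),
    encode_mod (Fin.is_lt _)] at hgood
  obtain ⟨u, v, e, rfl, rfl, he, y, hy⟩ := (passesAllTests_iff i.pos).1 hgood
  rw [Fin.val_inj] at he
  subst he
  obtain rfl := eq_of_sortCode_eq hx hy huv h1
  refine ⟨u, v, huv, hy, congrArg _ h1, h2, fun w => ?_⟩
  have := h3 w
  simpa only [← hval, Fin.val_inj] using this

theorem exists_describes (hn : 0 < n) (hH : InGeneralPosition H) {M : ℕ → ℕ}
    (h0 : M 0 = codeCount n (PassesAllTests H) (n ^ 3)) (h1 : M 1 = listBase n)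
    (hM : Listed n (PassesAllTests H) M) :
    ∃ A : AdjacencyStructure n, Holds M A ∧ A.Describes H := by
  classical
  have hG := isVertexRelation_passesAllTests hn hH
  have hvert : ∀ a : Fin (codeCount n (PassesAllTests H) (n ^ 3)), ∃ (i j k : Fin n)
      (x : EuclideanSpace ℝ (Fin 3)), i < j ∧ j < k ∧ IsVertexOf H i j k x ∧
        codeCount n (PassesAllTests H) (encode n i j k) = a := by
    intro a
    obtain ⟨i, j, k, hij, hjk, hg, hc⟩ := exists_isVertexCode a.2
    obtain ⟨i, j, k, rfl, rfl, rfl, x, hx⟩ := (passesAllTests_iff hn).1 hg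
    exact ⟨i, j, k, x, hij, hjk, hx, hc⟩
  choose I J K pt hIJ hJK hpt hcount using hvert
  have hedge := fun a => exists_edge hH (hIJ a) (hJK a) (hpt a)
  choose u v huv huvpt hrank hslot hplanes using hedge
  have hcode : ∀ a, IsVertexCode n (PassesAllTests H) (encode n (I a) (J a) (K a)) := fun a =>
    isVertexCode_encode hG (hIJ a) (hJK a) (passesAllTests_of_isVertexOf (hpt a))
  have hend : ∀ {u v e : Fin n} {y}, u < v → IsVertexOf H u v e y →
      IsEdgeEnd n (PassesAllTests H) (encode n u v e) := fun huv hy =>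
    isEdgeEnd_encode hG huv (passesAllTests_of_isVertexOf hy)
  -- The number stored for an edge end points to its geometric endpoint. This yields both that all
  -- vertices are listed and that neighbor links are correct.
  have hptr : ∀ {u v e : Fin n} {y} (huv : u < v) (hy : IsVertexOf H u v e y),
      pt ⟨rank n (PassesAllTests H) (encode n u v e), (hend huv hy).rank_lt hG⟩ = y := by
    intro u v e y huv hy
    refine eq_of_sortCode_eq (hpt _) hy huv ?_
    exact codeCount_injective ((hend huv hy).isVertexCode_sortCode hG) (hcode _)
      (hcount ⟨rank n _ (encode n u v e), (hend huv hy).rank_lt hG⟩).symm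
  have hdiv : ∀ u v e l : Fin n, encode n u v e / n * n + l = encode n u v l := by
    intro u v e l
    rw [encode_div e.2]
    rfl
  have hmono : ∀ a, StrictMono ![I a, J a, K a] := by
    intro a
    rw [Fin.strictMono_iff_lt_succ]
    intro s
    fin_cases s
    · exact hIJ a
    · exact hJK a
  have hthrough : ∀ a l, pt a ∈ (H l).plane ↔ ∃ s, ![I a, J a, K a] s = l := by
    intro a l
    rw [(hpt a).mem_plane_iff hH]
    simp [Fin.exists_fin_succ, eq_comm]
  -- Which `l` is chosen does not matter for the memory: `Listed.neighbor` holds for every valid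
  -- `l`.
  let nb : ∀ a, Fin 3 → Option (Fin (codeCount n (PassesAllTests H) (n ^ 3))) := fun a s =>
    if h : ∃ l, l ≠ ![I a, J a, K a] s ∧ ∃ y, IsVertexOf H (u a s) (v a s) l y then
      some ⟨rank n (PassesAllTests H) (encode n (u a s) (v a s) h.choose),
        (hend (huv a s) h.choose_spec.2.choose_spec).rank_lt hG⟩
    else none
  refine ⟨⟨_, fun a => ![I a, J a, K a], nb⟩, ⟨h0, fun a s => ?_⟩,
    ⟨pt, fun a b hab => ?_, ?_, fun a => ⟨hmono a, hthrough a⟩, fun a s => ?_⟩⟩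
  · have hE := hend (huv a s) (huvpt a s)
    have hr : rank n (PassesAllTests H) (encode n (u a s) (v a s) (![I a, J a, K a] s)) = a :=
      (hrank a s).trans (hcount a)
    constructor
    · have := hM.facet _ hE
      rwa [hr, hslot, encode_mod (Fin.is_lt _), ← h1] at this
    · by_cases h : ∃ l, l ≠ ![I a, J a, K a] s ∧ ∃ y, IsVertexOf H (u a s) (v a s) l y
      · have hl := h.choose_spec
        have := hM.neighbor _ h.choose hE h.choose.2
          (by rw [encode_mod (Fin.is_lt _)]; exact fun e => hl.1 (Fin.ext e))
          (by rw [hdiv]; exact hend (huv a s) hl.2.choose_spec)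
        rw [hr, hslot, ← h1, hdiv] at this
        rw [this]
        simp only [nb, dif_pos h]
        rfl
      · have := hM.no_neighbor _ hE fun l hl hne hE' => h ?_
        · rw [hr, hslot, ← h1] at this
          rw [this]
          simp only [nb, dif_neg h]
          rfl
        · have hg := hE'.2
          rw [hdiv _ _ _ ⟨l, hl⟩, encode_div_div (Fin.is_lt _) hl, encode_div_mod (Fin.is_lt _) hl,
            encode_mod hl] at hg
          obtain ⟨u', v', l', e1, e2, rfl, y, hy⟩ := (passesAllTests_iff hn).1 hg
          rw [Fin.val_inj] at e1 e2
          subst e1 e2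
          rw [encode_mod (Fin.is_lt _)] at hne
          exact ⟨l', fun e => hne (e ▸ rfl), y, hy⟩
  -- Equal points lie on the same planes, hence have the same increasing triple and the same number.
  · have hr : Set.range ![I a, J a, K a] = Set.range ![I b, J b, K b] := by
      ext l
      rw [Set.mem_range, Set.mem_range, ← hthrough, ← hthrough, hab]
    have he := (StrictMono.range_inj (hmono a) (hmono b)).1 hr
    have e0 : I a = I b := congrFun he 0
    have e1 : J a = J b := congrFun he 1
    have e2 : K a = K b := congrFun he 2
    exact Fin.ext (by rw [← hcount a, ← hcount b, e0, e1, e2])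
  · refine Set.Subset.antisymm ?_ fun x hx => ?_
    · rintro _ ⟨a, rfl⟩
      exact (hpt a).mem_extremePoints
    · obtain ⟨i, j, k, hij, -, hx⟩ := exists_isVertexOf hH hx
      exact ⟨_, hptr hij hx⟩
  · have hset : {x | x ∈ halfspaceInter H ∧ ∀ s', s' ≠ s → x ∈ (H (![I a, J a, K a] s')).plane} =
        {x | x ∈ halfspaceInter H ∧ x ∈ (H (u a s)).plane ∧ x ∈ (H (v a s)).plane} := by
      ext x
      refine and_congr_right fun _ => ⟨fun h => ?_, fun h s' hs' => ?_⟩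
      · obtain ⟨s₁, hs₁, e₁⟩ := (hplanes a s (u a s)).1 (Or.inl rfl)
        obtain ⟨s₂, hs₂, e₂⟩ := (hplanes a s (v a s)).1 (Or.inr rfl)
        rw [e₁, e₂]
        exact ⟨h s₁ hs₁, h s₂ hs₂⟩
      · rcases (hplanes a s _).2 ⟨s', hs', rfl⟩ with e | e
        · rw [e]; exact h.1
        · rw [e]; exact h.2
    dsimp only
    rw [hset]
    by_cases h : ∃ l, l ≠ ![I a, J a, K a] s ∧ ∃ y, IsVertexOf H (u a s) (v a s) l y
    · have hl := h.choose_spec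
      have hy := hl.2.choose_spec
      obtain ⟨hne, hseg⟩ := (huvpt a s).edge_eq_segment hH hy hl.1
      simp only [nb, dif_pos h]
      have hp := hptr (huv a s) hy
      refine ⟨fun e => ?_, by rw [hp, hseg]⟩
      rw [e] at hp
      exact hne hp.symm
    · simp only [nb, dif_neg h]
      exact (huvpt a s).edge_eq_ray fun l y hl hy => h ⟨l, hl, y, hy⟩

end adjacency

/-! ### The whole program -/

/-- Brute-force computation of the intersection of halfspaces, where every sidedness test is
repeated `K` times the binary logarithm of `n`. -/
def bruteForce (K : ℕ) : Prog :=
  .seq (setup K) <| .seq vote <| .seq majority <| .seq (prefixSum 2) <| .seq edgeEnds <|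
    .seq vertexCodes <| .seq (prefixSum 3) output

lemma exists_runs_bruteForce (K : ℕ) : ∃ D : ℕ, ∀ {n : ℕ} {H : Fin n → Halfspace} {W : ℕ}
    {err : ℕ × ℕ → Bool}, 2 ≤ n → InGeneralPosition H → listBase n ≤ W → K * Nat.clog 2 n ≤ W →
    (∀ i < n ^ 4, 2 * ((Finset.range (K * Nat.clog 2 n)).filter fun r =>
      err (testTime (setupTime K (Nat.clog 2 n)) r, i) = true).card < K * Nat.clog 2 n) →
    ∃ s : Config, Exec H W err (bruteForce K) (initial n) s ∧ s.span ≤ D * Nat.clog 2 n ∧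
      s.work ≤ D * Nat.clog 2 n * (7 * n ^ 4) ∧
      ∃ A : AdjacencyStructure n, Holds s.mem A ∧ A.Describes H := by
  obtain ⟨δ, hδ⟩ := exists_runs_output
  -- With `L = clog 2 n ≥ 1`, each duration is affine in `L` or bounded by such a function, so it is
  -- at most `L` times its value at `L = 1`. The argument `4` stems from `clog 2 (n ^ 4) ≤ 4 * L`.
  refine ⟨setupTime K 1 + (voteTime K + (majorityTime + (prefixSumTime 2 4 + (edgeEndsTime +
    (vertexCodesTime + (prefixSumTime 3 4 + δ)))))), fun {n H W err} hn hH hb hK herr => ?_⟩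
  have hn0 : 0 < n := by omega
  have hN : 1 ≤ n ^ 4 := Nat.one_le_pow _ _ hn0
  have hG := isVertexRelation_passesAllTests hn0 hH
  have hb' : 8 * n ^ 4 + 16 ≤ W := hb
  have hmonoT : Monotone (testCount H) := by
    classical
    exact Nat.count_monotone _
  have hmonoC : Monotone (codeCount n (PassesAllTests H)) := by
    classical
    exact Nat.count_monotone _
  have hT : testCount H (n ^ 4) ≤ n ^ 4 := by
    classical
    exact Nat.count_le _
  have hC := codeCount_le (n := n) (Good := PassesAllTests H) (n ^ 4)
  -- The bound `6 * n ^ 4` on the processors is dictated by clearing six words per vertex.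
  have hrun : Runs H W (6 * n ^ 4) err (bruteForce K) 0 _ _ _ :=
    Runs.seq (runs_setup K (by omega) hn (by omega) hK) <|
    Runs.seq (runs_vote (by omega) (by omega) hK (by omega)) <|
    Runs.seq (runs_majority (t₀ := 0 + setupTime K (Nat.clog 2 n)) (by omega) (by omega)
      (by simpa using herr)) <|
    Runs.seq (runs_prefixSum (by omega) (by omega) hN (by omega) hmonoT (by simp [testCount])
      (by omega) fun M M' h => fun ⟨ha, hc⟩ =>
        ⟨by rw [h _ (by omega) fun y => cell_ne (by omega) _ _, ha],
          by rw [h _ (cell_ne (by omega) _ _) fun y => by unfold cell; omega, hc]⟩) <|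
    Runs.seq (runs_edgeEnds hn0 (by omega) (by omega)) <|
    Runs.seq (runs_vertexCodes (by omega) (by omega)) <|
    Runs.seq (runs_prefixSum (by omega) (by omega) hN (by omega) hmonoC (by simp [codeCount])
      (by omega) fun M M' h => fun ⟨ha, hc⟩ =>
        ⟨by rw [h _ (by omega) fun y => cell_ne (by omega) _ _, ha], fun x hx => by
          rw [h _ (cell_ne (by omega) _ _) fun y => by unfold cell; omega, hc x hx]⟩) <|
    hδ hG hn0 le_rfl hb
  obtain ⟨s, hexec, ⟨h0, h1, hlist⟩, hspan, hwork⟩ := hrun (initial n) rfl rfl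
  have hL : 1 ≤ Nat.clog 2 n := Nat.clog_pos (by norm_num) hn
  have hL4 : Nat.clog 2 (n ^ 4) ≤ 4 * Nat.clog 2 n := by
    apply Nat.clog_le_of_le_pow
    calc n ^ 4 ≤ (2 ^ Nat.clog 2 n) ^ 4 := Nat.pow_le_pow_left (Nat.le_pow_clog (by norm_num) n) 4
      _ = 2 ^ (4 * Nat.clog 2 n) := by rw [← pow_mul, mul_comm]
  generalize Nat.clog 2 n = L at *
  generalize Nat.clog 2 (n ^ 4) = T at *
  have hconst : ∀ a : ℕ, a ≤ a * L := fun a => Nat.le_mul_of_pos_right _ hL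
  have hpre : ∀ r, prefixSumTime r T ≤ prefixSumTime r 4 * L := by
    intro r
    have := Nat.mul_le_mul_right (prefixSumStep r) hL4
    have h1 := hconst (setVarTime 1)
    have h2 := hconst (Expr.less (Expr.var 3) (Expr.var 2)).size
    unfold prefixSumTime
    nlinarith
  have hset : setupTime K L ≤ setupTime K 1 * L := by
    have h1 := hconst (setVarTime 1)
    have h2 := hconst (Expr.less (Expr.var 3) (Expr.var 0)).size
    have h3 := hconst (setVarTime (Expr.var 0 * Expr.var 0 * Expr.var 0 * Expr.var 0))
    unfold setupTime
    nlinarith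
  have hvote : voteTime (K * L) ≤ voteTime K * L := by
    have h2 := hconst (Expr.less (Expr.var 5) (Expr.var 4)).size
    unfold voteTime
    nlinarith
  have hle : s.span ≤ (setupTime K 1 + (voteTime K + (majorityTime + (prefixSumTime 2 4 +
      (edgeEndsTime + (vertexCodesTime + (prefixSumTime 3 4 + δ))))))) * L := by
    rw [hspan]
    simp only [add_mul, zero_add]
    have := hpre 2
    have := hpre 3
    have := hconst majorityTime
    have := hconst edgeEndsTime
    have := hconst vertexCodesTime
    have := hconst δ
    omega
  refine ⟨s, hexec, hle, ?_, exists_describes hn0 hH h0 h1 hlist⟩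
  rw [zero_add] at hspan
  rw [← hspan] at hwork
  calc s.work ≤ s.span * (6 * n ^ 4 + 1) := by simpa [initial] using hwork
    _ ≤ _ := Nat.mul_le_mul hle (by omega)

/-! ### Distinct test times and bounds for logarithms -/

/-- Each round takes positive time, so the repetitions of a test use different, hence independent,
error bits. -/
lemma testTime_injective (t : ℕ) : Function.Injective (testTime t) := by
  intro r r' h
  have hpos : 0 < voteStep := by
    unfold voteStep testAllTime
    omega
  unfold testTime at h
  exact Nat.eq_of_mul_eq_mul_right hpos (by omega)

lemma log_le_clog {n : ℕ} (hn : 2 ≤ n) : Real.log n ≤ Nat.clog 2 n := by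
  have h1 : (n : ℝ) ≤ 2 ^ Nat.clog 2 n := by
    exact_mod_cast Nat.le_pow_clog (by norm_num) n
  have h2 := Real.log_le_log (by positivity) h1
  rw [Real.log_pow] at h2
  have h3 : Real.log 2 ≤ 1 := by linarith [Real.log_two_lt_d9]
  nlinarith [(Nat.cast_nonneg (Nat.clog 2 n) : (0 : ℝ) ≤ _)]

/-- With `clog 2 n = m + 1`, both `m * log 2` and `log 2` are at most `log n`, and `2 / log 2 < 3`.
-/
lemma clog_le_three_mul_log {n : ℕ} (hn : 2 ≤ n) : (Nat.clog 2 n : ℝ) ≤ 3 * Real.log n := by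
  have hL : 1 ≤ Nat.clog 2 n := Nat.clog_pos (by norm_num) hn
  obtain ⟨m, hm⟩ : ∃ m, Nat.clog 2 n = m + 1 := ⟨Nat.clog 2 n - 1, by omega⟩
  have h1 : 2 ^ m < n := Nat.pow_lt_of_lt_clog (by omega)
  have h2 : ((2 : ℝ)) ^ m ≤ n := by exact_mod_cast h1.le
  have h3 := Real.log_le_log (by positivity) h2
  rw [Real.log_pow] at h3
  have h4 : Real.log 2 ≤ Real.log n := Real.log_le_log (by norm_num) (by exact_mod_cast hn)
  have h5 := Real.log_two_gt_d9
  rw [hm]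
  push_cast
  have h6 : (0 : ℝ) ≤ m := Nat.cast_nonneg m
  nlinarith

end PRAM

/-- For every error rate `p < 1/2` and every exponent `c` there are a single CREW PRAM program,
a constant `k` (words have at most `k * log n` bits) and a constant `C` such that, for every
`n ≥ 2` and all `n` halfspaces in general position, if the error bits of the primitives are
independent and each is `true` with probability at most `p`, then, outside of an event of
probability at most `n ^ (-c)`, the program computes the intersection of the halfspaces in span
at most `C * log n` and work at most `C * n ^ 4 * log n`. -/
theorem mainTheorem8 (p : ℝ) (hp₀ : 0 ≤ p) (hp : p < 1 / 2) (c : ℝ) :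
    ∃ (P : PRAM.Prog) (k : ℕ) (C : ℝ), ∀ (n : ℕ), 2 ≤ n →
      ∀ H : Fin n → Halfspace, InGeneralPosition H →
      ∀ (Ω : Type*) [MeasurableSpace Ω] (μ : Measure Ω) [IsProbabilityMeasure μ]
        (err : ℕ × ℕ → Ω → Bool),
        (∀ q, Measurable (err q)) →
        iIndepFun err μ →
        (∀ q, μ {ω | err q ω = true} ≤ ENNReal.ofReal p) →
        μ {ω | ¬ PRAM.ComputesIntersection P H (n ^ k) (fun q => err q ω)
            (C * Real.log n) (C * (n : ℝ) ^ 4 * Real.log n)}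
          ≤ ENNReal.ofReal ((n : ℝ) ^ (-c)) := by
  -- The `4` pays for the union bound over `n ^ 4` votes; `|c|` keeps the factor nonnegative for
  -- every real `c`.
  obtain ⟨K, hK⟩ := exists_nat_ge ((4 + |c|) / (2 * (1 / 2 - p) ^ 2))
  have hgap : 0 < 2 * (1 / 2 - p) ^ 2 := by
    have : 0 < 1 / 2 - p := by linarith
    positivity
  rw [div_le_iff₀ hgap] at hK
  obtain ⟨D, hD⟩ := PRAM.exists_runs_bruteForce K
  -- Words must hold `K * clog 2 n`, where `K ≤ n ^ K`, and `8 * n ^ 4 + 16 ≤ 2 ^ 5 * n ^ 4 ≤ n ^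
  -- 9`. The constant is `21 = 3 * 7`, from `clog 2 n ≤ 3 * log n` and `6 * n ^ 4 + 1 ≤ 7 * n ^ 4`.
  refine ⟨PRAM.bruteForce K, K + 9, 21 * D, fun n hn H hH Ω _ μ _ err hm hind herr => ?_⟩
  have hn0 : 0 < n := by omega
  have hlog : 0 ≤ Real.log n := Real.log_natCast_nonneg n
  have hL := PRAM.log_le_clog hn
  have hL3 := PRAM.clog_le_three_mul_log hn
  have hclog : Nat.clog 2 n ≤ n := Nat.clog_le_of_le_pow Nat.lt_two_pow_self.le
  have hW₁ : K * Nat.clog 2 n ≤ n ^ (K + 9) := by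
    rw [pow_add]
    refine Nat.mul_le_mul ?_ (hclog.trans (Nat.le_self_pow (by norm_num) n))
    exact Nat.lt_two_pow_self.le.trans (Nat.pow_le_pow_left hn K)
  have hW₂ : PRAM.listBase n ≤ n ^ (K + 9) := by
    have h1 : n ^ 9 ≤ n ^ (K + 9) := Nat.pow_le_pow_right hn0 (by omega)
    have h2 : 2 ^ 5 * n ^ 4 ≤ n ^ 5 * n ^ 4 := Nat.mul_le_mul_right _ (Nat.pow_le_pow_left hn 5)
    rw [← pow_add, show 5 + 4 = 9 from rfl] at h2
    have h3 : 1 ≤ n ^ 4 := Nat.one_le_pow _ _ hn0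
    unfold PRAM.listBase
    omega
  refine (measure_mono ?_).trans (measure_exists_majority_wrong_le hm hind hp₀ hp herr
    (q := fun i r => (PRAM.testTime (PRAM.setupTime K (Nat.clog 2 n)) r, i))
    (fun i r r' h => PRAM.testTime_injective _ (congrArg Prod.fst h)) hn0 (e := 4)
    (R := K * Nat.clog 2 n) ?_)
  · intro ω hω
    simp only [Set.mem_ofPred_eq] at hω ⊢
    by_contra! hc
    refine hω ?_
    obtain ⟨s, hexec, hspan, hwork, hA⟩ := hD (err := fun q => err q ω) hn hH hW₂ hW₁ hc
    have hspan' : (s.span : ℝ) ≤ D * Nat.clog 2 n := by exact_mod_cast hspan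
    have hwork' : (s.work : ℝ) ≤ D * Nat.clog 2 n * (7 * n ^ 4) := by exact_mod_cast hwork
    have hDL : (D : ℝ) * Nat.clog 2 n ≤ D * (3 * Real.log n) :=
      mul_le_mul_of_nonneg_left hL3 (Nat.cast_nonneg _)
    have hDlog : 0 ≤ (D : ℝ) * Real.log n := mul_nonneg (Nat.cast_nonneg _) hlog
    refine ⟨s, hexec, by linarith, hwork'.trans ?_, hA⟩
    calc (D : ℝ) * Nat.clog 2 n * (7 * n ^ 4) ≤ D * (3 * Real.log n) * (7 * n ^ 4) :=
          mul_le_mul_of_nonneg_right hDL (by positivity)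
      _ = 21 * D * n ^ 4 * Real.log n := by ring
  · have h1 : (4 + c) * Real.log n ≤ (4 + |c|) * Real.log n :=
      mul_le_mul_of_nonneg_right (by linarith [le_abs_self c]) hlog
    have h2 : (4 + |c|) * Real.log n ≤ (4 + |c|) * Nat.clog 2 n :=
      mul_le_mul_of_nonneg_left hL (by positivity)
    have h3 : (4 + |c|) * Nat.clog 2 n ≤ K * (2 * (1 / 2 - p) ^ 2) * Nat.clog 2 n :=
      mul_le_mul_of_nonneg_right hK (Nat.cast_nonneg _)
    push_cast
    linarith
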